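/- Let $\mathbb K$ be a field. Let $\mathbf{Op}$ be the category of finitely generated binary quadratic symmetric operads over $\mathbb K$ and all morphisms of operads. Such an operad $\mathcal O$ is given by a finite dimensional space $E$ of generating binary operations, with the involution $e\mapsto e^{op}$, $x\,e^{op}\,y=y\,e\,x$, and by relations between multilinear monomials in three variables. (Non-symmetric, commutative and anti-commutative generating products contribute to $E$ the regular, the trivial and the sign representation of $S_2$.) For a vector space $V$ let $C^*(\Delta_1;V)$ be the complex of non-degenerate cochains on the $1$-simplex with coefficients in $V$, with basis cochains the left vertex $l$, the right vertex $r$ and the edge $\epsilon$: a $0$-cochain is $l_x+r_y$, a $1$-cochain is $\epsilon_x$ ($x,y\in V$), and $d(l_x+r_y)=\epsilon_{y-x}$. The cup product on $C^*(\Delta_1;\mathbb K)$ is given by $l\cup l=l$, $r\cup r=r$, $l\cup\epsilon=\epsilon\cup r=\epsilon$, the other products of basis cochains being $0$; $\cup^{op}$ is the opposite product, and $[-,-]=\cup-\cup^{op}$. Let $C^*(\Delta_1,v_l;V)\subset C^*(\Delta_1;V)$ be the subcomplex of the cochains vanishing at the left vertex. A dg $\mathcal O$-algebra structure on one of these complexes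 is *local* if for every set $X$ of vertices the cochains vanishing on $X$ form a dg ideal. Define endofunctors of $\mathbf{Op}$ as follows. * An $\operatorname{Ass}_\bullet(\mathcal O)$-algebra structure on $V$ is a local dg $\mathcal O$-algebra structure on $C^*(\Delta_1;V)$; the generating operations of $\operatorname{Ass}_\bullet(\mathcal O)$ are $\underline e$ and $\overline e$, linear in $e\in E$, where $\epsilon_x\,e\,r_y=\epsilon_{x\underline e y}$ and $r_x\,e\,\epsilon_y=\epsilon_{x\overline e y}$. The operad $\operatorname{preLie}_\bullet(\mathcal O)$ is defined in the same way with $C^*(\Delta_1,v_l;V)$ in place of $C^*(\Delta_1;V)$. * A $\operatorname{Com}_\bullet(\mathcal O)$-algebra is an $\operatorname{Ass}_\bullet(\mathcal O)$-algebra whose associated $\mathcal O$-algebra, given by $r_x\,e\,r_y=r_{x\cdot_e y}$, is trivial; that is, $\underline e=-\overline e$. Its generating operations are the $\underline e$. * The operad $\operatorname{Ass}_\circ(\mathcal O)$ is generated by operations $\cup\otimes e$ and $\cup^{op}\otimes e$, linear in $e\in E$, with $(\cup\otimes e)^{op}=\cup^{op}\otimes e^{op}$; its relations are all those that hold for the tensor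 product operations on $C^*(\Delta_1;\mathbb K)\otimes V=C^*(\Delta_1;V)$ for all $\mathcal O$-algebras $V$. The operad $\operatorname{Perm}_\circ(\mathcal O)$ is defined in the same way with $C^*(\Delta_1,v_l;V)$. * The operad $\operatorname{Lie}_\circ(\mathcal O)$ is generated by operations $[-,-]\otimes e$, linear in $e\in E$, with $([-,-]\otimes e)^{op}=-[-,-]\otimes e^{op}$; its relations are all those that hold for the tensor product operations on $C^*(\Delta_1;V)$ for all $\mathcal O$-algebras $V$. A morphism $f$ acts on generating operations by $\underline e\mapsto\underline{f(e)}$, $\overline e\mapsto\overline{f(e)}$, $\cup\otimes e\mapsto\cup\otimes f(e)$, $\cup^{op}\otimes e\mapsto\cup^{op}\otimes f(e)$, $[-,-]\otimes e\mapsto[-,-]\otimes f(e)$. **Theorem.** The pairs $(\operatorname{Ass}_\bullet,\operatorname{Ass}_\circ)$, $(\operatorname{Com}_\bullet,\operatorname{Lie}_\circ)$ and $(\operatorname{preLie}_\bullet,\operatorname{Perm}_\circ)$ are pairs of adjoint functors $\mathbf{Op}\rightleftarrows\mathbf{Op}$, the first functor of each pair being the left adjoint. In the first and the third case the adjunction can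 be chosen such that the unit is $e\mapsto\cup\otimes\underline e+\cup^{op}\otimes\overline e$, and the counit is $\underline{\cup\otimes e}\mapsto e$, $\overline{\cup^{op}\otimes e}\mapsto e$, $\overline{\cup\otimes e}\mapsto0$, $\underline{\cup^{op}\otimes e}\mapsto0$, on generating operations $e$. In the second case it can be chosen such that the unit is $e\mapsto[-,-]\otimes\underline e$ and the counit is $\underline{[-,-]\otimes e}\mapsto e$. -/

import Mathlib

set_option linter.unusedSectionVars false

open CategoryTheory

universe u

namespace ManinTrick

section Trees

/-- Monomials in binary operation symbols `e : E` and variables `a : A`. -/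
inductive Tree (E : Type u) (A : Type) : Type u
  | leaf (a : A) : Tree E A
  | node (e : E) (s t : Tree E A) : Tree E A

variable {E E' : Type u} {A B C : Type}

/-- The variables of a monomial, from left to right. -/
def Tree.leaves : Tree E A → List A
  | .leaf a => [a]
  | .node _ s t => s.leaves ++ t.leaves

/-- Substitution of monomials for the variables. -/
def Tree.bind (f : A → Tree E B) : Tree E A → Tree E B
  | .leaf a => f a
  | .node e s t => .node e (s.bind f) (t.bind f)

/-- Renaming of the operation symbols. -/
def Tree.mapOps (f : E → E') : Tree E A → Tree E' A
  | .leaf a => .leaf a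
  | .node e s t => .node (f e) (s.mapOps f) (t.mapOps f)

/-- Every variable occurs exactly once. -/
def Tree.IsMultilinear (t : Tree E A) : Prop :=
  t.leaves.Nodup ∧ ∀ a, a ∈ t.leaves

theorem Tree.leaves_bind (f : A → Tree E B) (t : Tree E A) :
    (t.bind f).leaves = t.leaves.flatMap fun a => (f a).leaves := by
  induction t with
  | leaf a => simp [Tree.bind, Tree.leaves]
  | node e s t hs ht => simp [Tree.bind, Tree.leaves, hs, ht]

theorem Tree.leaves_mapOps (f : E → E') (t : Tree E A) :
    (t.mapOps f).leaves = t.leaves := by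
  induction t with
  | leaf a => simp [Tree.mapOps, Tree.leaves]
  | node e s t hs ht => simp [Tree.mapOps, Tree.leaves, hs, ht]

/-- The multilinear monomials with set of variables `A`. -/
abbrev Mono (E : Type u) (A : Type) : Type u := {t : Tree E A // t.IsMultilinear}

/-- Renaming of the variables along a bijection. -/
def Mono.map (σ : A ≃ B) (t : Mono E A) : Mono E B :=
  ⟨t.1.bind fun a => .leaf (σ a), by
    have h : (t.1.bind fun a => .leaf (σ a)).leaves = t.1.leaves.map σ := by
      rw [Tree.leaves_bind]
      simp only [Tree.leaves]
      exact List.map_eq_flatMap.symm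
    refine ⟨?_, fun b => ?_⟩
    · rw [h]; exact t.2.1.map σ.injective
    · rw [h]; exact List.mem_map.2 ⟨σ.symm b, t.2.2 _, by simp⟩⟩

/-- Grafting: the monomial `t` is substituted for the variable `none` of `s`. -/
def Mono.graft (s : Mono E (Option A)) (t : Mono E B) : Mono E (A ⊕ B) :=
  ⟨s.1.bind fun o => o.elim (t.1.bind fun b => .leaf (Sum.inr b)) fun a => .leaf (Sum.inl a), by
    have ht : (t.1.bind fun b => Tree.leaf (E := E) (Sum.inr (α := A) b)).leaves
        = t.1.leaves.map Sum.inr := by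
      rw [Tree.leaves_bind]
      simp only [Tree.leaves]
      exact List.map_eq_flatMap.symm
    refine ⟨?_, ?_⟩
    · rw [Tree.leaves_bind, List.nodup_flatMap]
      refine ⟨?_, ?_⟩
      · rintro (_ | a) -
        · simp only [Option.elim, ht]
          exact t.2.1.map Sum.inr_injective
        · simp [Tree.leaves]
      · refine s.2.1.imp ?_
        rintro (_ | a) (_ | b) hab <;>
          simp_all [Function.onFun, Tree.leaves]
        exact fun h => hab h.symm
    · rintro (a | b)
      · rw [Tree.leaves_bind, List.mem_flatMap]
        exact ⟨some a, s.2.2 _, by simp [Tree.leaves]⟩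
      · rw [Tree.leaves_bind, List.mem_flatMap]
        refine ⟨none, s.2.2 _, ?_⟩
        simp only [Option.elim, ht]
        exact List.mem_map.2 ⟨b, t.2.2 _, rfl⟩⟩

/-- Renaming of the operation symbols in a multilinear monomial. -/
def Mono.mapOps (f : E → E') (t : Mono E A) : Mono E' A :=
  ⟨t.1.mapOps f, by
    have h := t.2
    unfold Tree.IsMultilinear at h ⊢
    rwa [Tree.leaves_mapOps]⟩

end Trees

section Eval

variable {K : Type u} [Field K] {E E' : Type u} [AddCommGroup E] [Module K E]
  [AddCommGroup E'] [Module K E'] {V : Type u} [AddCommGroup V] [Module K V] {A B C : Type}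

/-- Families of bilinear operations on `V`, depending linearly on `e : E`. -/
abbrev BinOps (K : Type u) [Field K] (E : Type u) [AddCommGroup E] [Module K E]
    (V : Type u) [AddCommGroup V] [Module K V] : Type u :=
  E →ₗ[K] V →ₗ[K] V →ₗ[K] V

/-- The value of a monomial. -/
def Tree.eval (m : BinOps K E V) (v : A → V) : Tree E A → V
  | .leaf a => v a
  | .node e s t => m e (s.eval m v) (t.eval m v)

/-- Formal linear combinations of multilinear monomials. -/
abbrev FreeOps (K : Type u) [Field K] (E : Type u) (A : Type) : Type u := Mono E A →₀ K

/-- The value of a formal linear combination of multilinear monomials. -/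
noncomputable def evalFree (m : BinOps K E V) (v : A → V) : FreeOps K E A →ₗ[K] V :=
  Finsupp.linearCombination K fun t => t.1.eval m v

theorem evalFree_single (m : BinOps K E V) (v : A → V) (t : Mono E A) (c : K) :
    evalFree m v (Finsupp.single t c) = c • t.1.eval m v := by
  simp [evalFree]

theorem Tree.eval_bind (m : BinOps K E V) (v : B → V) (f : A → Tree E B) (t : Tree E A) :
    (t.bind f).eval m v = t.eval m fun a => (f a).eval m v := by
  induction t with
  | leaf a => rfl
  | node e s t hs ht => simp [Tree.bind, Tree.eval, hs, ht]

theorem Tree.eval_mapOps (m : BinOps K E' V) (v : A → V) (f : E →ₗ[K] E') (t : Tree E A) :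
    (t.mapOps f).eval m v = t.eval (m ∘ₗ f) v := by
  induction t with
  | leaf a => rfl
  | node e s t hs ht => simp [Tree.mapOps, Tree.eval, hs, ht]

theorem Tree.eval_congr (m : BinOps K E V) {v w : A → V} (t : Tree E A)
    (h : ∀ a ∈ t.leaves, v a = w a) : t.eval m v = t.eval m w := by
  induction t with
  | leaf a => exact h a (by simp [Tree.leaves])
  | node e s t hs ht =>
    simp only [Tree.leaves, List.mem_append] at h
    simp [Tree.eval, hs fun a ha => h a (Or.inl ha), ht fun a ha => h a (Or.inr ha)]

theorem Tree.eval_update [DecidableEq A] (m : BinOps K E V) (v : A → V) (a : A) (t : Tree E A)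
    (hn : t.leaves.Nodup) (ha : a ∈ t.leaves) :
    ∃ L : V →ₗ[K] V, ∀ x, t.eval m (Function.update v a x) = L x := by
  induction t with
  | leaf b =>
    simp only [Tree.leaves, List.mem_singleton] at ha
    subst ha
    exact ⟨LinearMap.id, fun x => by simp [Tree.eval]⟩
  | node e s t hs ht =>
    simp only [Tree.leaves, List.nodup_append, List.mem_append] at hn ha
    have key : ∀ r : Tree E A, a ∉ r.leaves → ∀ x,
        r.eval m (Function.update v a x) = r.eval m v := fun r hr x =>
      r.eval_congr m fun b hb => Function.update_of_ne (fun h : b = a => hr (h ▸ hb)) _ _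
    rcases ha with ha | ha
    · obtain ⟨L, hL⟩ := hs hn.1 ha
      have hat : a ∉ t.leaves := fun h => hn.2.2 a ha a h rfl
      exact ⟨(m e).flip (t.eval m v) ∘ₗ L, fun x => by simp [Tree.eval, hL, key t hat]⟩
    · obtain ⟨L, hL⟩ := ht hn.2.1 ha
      have has : a ∉ s.leaves := fun h => hn.2.2 a h a ha rfl
      exact ⟨m e (s.eval m v) ∘ₗ L, fun x => by simp [Tree.eval, hL, key s has]⟩

/-- The multilinear map defined by a multilinear monomial. -/
def Mono.evalMulti (m : BinOps K E V) (t : Mono E A) : MultilinearMap K (fun _ : A => V) V where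
  toFun v := t.1.eval m v
  map_update_add' v a x y := by
    obtain ⟨L, hL⟩ := t.1.eval_update m v a t.2.1 (t.2.2 a)
    simp [hL]
  map_update_smul' v a c x := by
    obtain ⟨L, hL⟩ := t.1.eval_update m v a t.2.1 (t.2.2 a)
    simp [hL]

/-- The multilinear map defined by a formal linear combination of multilinear monomials. -/
noncomputable def evalMulti (m : BinOps K E V) :
    FreeOps K E A →ₗ[K] MultilinearMap K (fun _ : A => V) V :=
  Finsupp.linearCombination K fun t => t.evalMulti m

theorem evalMulti_apply (m : BinOps K E V) (p : FreeOps K E A) (v : A → V) :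
    evalMulti m p v = evalFree m v p := by
  induction p using Finsupp.induction_linear with
  | zero => simp
  | add p q hp hq => simp [hp, hq]
  | single t c => simp [evalMulti, evalFree, Mono.evalMulti]

/-- Renaming of the variables along a bijection. -/
noncomputable def FreeOps.map (σ : A ≃ B) : FreeOps K E A →ₗ[K] FreeOps K E B :=
  Finsupp.lmapDomain K K (Mono.map σ)

/-- Substitution for the variable `none`, extended bilinearly. -/
noncomputable def FreeOps.comp :
    FreeOps K E (Option A) →ₗ[K] FreeOps K E B →ₗ[K] FreeOps K E (A ⊕ B) :=
  Finsupp.linearCombination K fun s => Finsupp.lmapDomain K K (Mono.graft s)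

/-- Linear extension of a renaming of the operation symbols. -/
noncomputable def FreeOps.mapOps (f : E → E') : FreeOps K E A →ₗ[K] FreeOps K E' A :=
  Finsupp.lmapDomain K K (Mono.mapOps f)

theorem evalFree_map (m : BinOps K E V) (v : B → V) (σ : A ≃ B) (p : FreeOps K E A) :
    evalFree m v (FreeOps.map σ p) = evalFree m (fun a => v (σ a)) p := by
  induction p using Finsupp.induction_linear with
  | zero => simp
  | add p q hp hq => simp [hp, hq]
  | single t c => simp [evalFree, FreeOps.map, Mono.map, Tree.eval_bind, Tree.eval]

theorem evalFree_mapOps (m : BinOps K E' V) (v : A → V) (f : E →ₗ[K] E') (p : FreeOps K E A) :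
    evalFree m v (FreeOps.mapOps f p) = evalFree (m ∘ₗ f) v p := by
  induction p using Finsupp.induction_linear with
  | zero => simp
  | add p q hp hq => simp [hp, hq]
  | single t c => simp [evalFree, FreeOps.mapOps, Mono.mapOps, Tree.eval_mapOps]

theorem elim_eq_update {X : Type*} [DecidableEq (Option A)] (f : A → X) (x y : X) :
    (fun o : Option A => o.elim x f) = Function.update (fun o : Option A => o.elim y f) none x := by
  funext o
  cases o <;> simp

theorem evalFree_comp (m : BinOps K E V) (v : A ⊕ B → V) (p : FreeOps K E (Option A))
    (q : FreeOps K E B) :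
    evalFree m v (FreeOps.comp p q) =
      evalFree m (fun o => o.elim (evalFree m (fun b => v (Sum.inr b)) q)
        fun a => v (Sum.inl a)) p := by
  classical
  induction p using Finsupp.induction_linear with
  | zero => simp
  | add p p' hp hp' => simp [hp, hp']
  | single s c =>
    rw [evalFree_single]
    simp only [FreeOps.comp, Finsupp.linearCombination_single, LinearMap.smul_apply, map_smul]
    congr 1
    obtain ⟨L, hL⟩ := s.1.eval_update m (fun o => o.elim 0 fun a => v (Sum.inl a)) none s.2.1
      (s.2.2 none)
    rw [elim_eq_update _ _ 0, hL]
    induction q using Finsupp.induction_linear with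
    | zero => simp
    | add p q hp hq => rw [map_add, map_add, map_add, map_add, hp, hq]
    | single t c =>
      rw [Finsupp.lmapDomain_apply, Finsupp.mapDomain_single, evalFree_single, evalFree_single,
        map_smul, ← hL, ← elim_eq_update]
      congr 1
      simp only [Mono.graft, Tree.eval_bind]
      congr 1
      funext o
      cases o <;> simp [Tree.eval, Tree.eval_bind]

end Eval

section Operads

/-- The marked input of the first summand. -/
def leftOption (A B : Type) : Option A ⊕ B ≃ Option (A ⊕ B) where
  toFun := Sum.elim (fun o => o.map Sum.inl) fun b => some (Sum.inr b)
  invFun o := o.elim (Sum.inl none) (Sum.map some id)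
  left_inv := by rintro ((_ | _) | _) <;> rfl
  right_inv := by rintro (_ | (_ | _)) <;> rfl

/-- The marked input of the second summand. -/
def rightOption (A B : Type) : A ⊕ Option B ≃ Option (A ⊕ B) where
  toFun := Sum.elim (fun a => some (Sum.inl a)) fun o => o.map Sum.inr
  invFun o := o.elim (Sum.inr none) (Sum.map id some)
  left_inv := by rintro (_ | (_ | _)) <;> rfl
  right_inv := by rintro (_ | (_ | _)) <;> rfl

/-- Exchange of the two marked inputs. -/
def swapOption (A : Type) : Option (Option A) ≃ Option (Option A) where
  toFun
    | none => some none
    | some none => none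
    | some (some a) => some (some a)
  invFun
    | none => some none
    | some none => none
    | some (some a) => some (some a)
  left_inv := by rintro (_ | (_ | _)) <;> rfl
  right_inv := by rintro (_ | (_ | _)) <;> rfl

/-- Exchange of the last two summands. -/
def sumRightComm (A B C : Type) : (A ⊕ C) ⊕ B ≃ (A ⊕ B) ⊕ C where
  toFun := Sum.elim (Sum.elim (fun a => Sum.inl (Sum.inl a)) Sum.inr) fun b => Sum.inl (Sum.inr b)
  invFun := Sum.elim (Sum.elim (fun a => Sum.inl (Sum.inl a)) Sum.inr) fun c => Sum.inl (Sum.inr c)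
  left_inv := by rintro ((_ | _) | _) <;> rfl
  right_inv := by rintro ((_ | _) | _) <;> rfl

/-- The bijection between a point and the set consisting of one marked point. -/
def unitOption : Unit ≃ Option Empty where
  toFun _ := none
  invFun _ := ()
  left_inv _ := rfl
  right_inv := by rintro (_ | ⟨⟨⟩⟩); rfl

/-- Symmetric operads in `K`-vector spaces, in the form with partial compositions: `obj A` is the
space of operations whose inputs are labelled by the finite set `A`, and `comp p q` inserts `q` into
the input `none` of `p`. -/
structure SymmetricOperad (K : Type u) [Field K] where
  obj : (A : Type) → [Finite A] → Type u
  [addCommGroup : ∀ (A : Type) [Finite A], AddCommGroup (obj A)]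
  [module : ∀ (A : Type) [Finite A], Module K (obj A)]
  map : ∀ {A B : Type} [Finite A] [Finite B], A ≃ B → obj A →ₗ[K] obj B
  one : obj Unit
  comp : ∀ {A B : Type} [Finite A] [Finite B], obj (Option A) →ₗ[K] obj B →ₗ[K] obj (A ⊕ B)
  map_refl : ∀ {A : Type} [Finite A] (p : obj A), map (Equiv.refl A) p = p
  map_trans : ∀ {A B C : Type} [Finite A] [Finite B] [Finite C] (σ : A ≃ B) (τ : B ≃ C)
    (p : obj A), map (σ.trans τ) p = map τ (map σ p)
  comp_map : ∀ {A A' B B' : Type} [Finite A] [Finite A'] [Finite B] [Finite B'] (σ : A ≃ A')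
    (τ : B ≃ B') (p : obj (Option A)) (q : obj B),
    comp (map (Equiv.optionCongr σ) p) (map τ q) = map (Equiv.sumCongr σ τ) (comp p q)
  one_comp : ∀ {B : Type} [Finite B] (q : obj B),
    map (Equiv.emptySum Empty B) (comp (map unitOption one) q) = q
  comp_one : ∀ {A : Type} [Finite A] (p : obj (Option A)),
    map (Equiv.optionEquivSumPUnit A).symm (comp p one) = p
  comp_comp : ∀ {A B C : Type} [Finite A] [Finite B] [Finite C] (p : obj (Option A))
    (q : obj (Option B)) (r : obj C),
    map (Equiv.sumAssoc A B C) (comp (map (rightOption A B) (comp p q)) r) = comp p (comp q r)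
  comp_right_comm : ∀ {A B C : Type} [Finite A] [Finite B] [Finite C]
    (p : obj (Option (Option A))) (q : obj B) (r : obj C),
    comp (map (leftOption A B) (comp p q)) r =
      map (sumRightComm A B C)
        (comp (map (leftOption A C) (comp (map (swapOption A) p) r)) q)

attribute [instance] SymmetricOperad.addCommGroup SymmetricOperad.module

/-- Morphisms of symmetric operads. -/
@[ext]
structure SymmetricOperad.Hom {K : Type u} [Field K] (P Q : SymmetricOperad K) where
  app : (A : Type) → [Finite A] → P.obj A →ₗ[K] Q.obj A
  app_map : ∀ {A B : Type} [Finite A] [Finite B] (σ : A ≃ B) (p : P.obj A),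
    app B (P.map σ p) = Q.map σ (app A p)
  app_one : app Unit P.one = Q.one
  app_comp : ∀ {A B : Type} [Finite A] [Finite B] (p : P.obj (Option A)) (q : P.obj B),
    app (A ⊕ B) (P.comp p q) = Q.comp (app (Option A) p) (app B q)

instance (K : Type u) [Field K] : Category (SymmetricOperad K) where
  Hom P Q := SymmetricOperad.Hom P Q
  id P :=
    { app := fun _ _ => LinearMap.id
      app_map := fun _ _ => rfl
      app_one := rfl
      app_comp := fun _ _ => rfl }
  comp f g :=
    { app := fun A _ => g.app A ∘ₗ f.app A
      app_map := fun σ p => by simp [f.app_map, g.app_map]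
      app_one := by simp [f.app_one, g.app_one]
      app_comp := fun p q => by simp [f.app_comp, g.app_comp] }

end Operads

section Presentations

/-- Finitely generated binary quadratic operads, given by a presentation: a finite dimensional space
`E` of generating binary operations, with the involution `op` taking an operation to the opposite
one, and a set of relators, which are linear combinations of multilinear monomials in three
variables. A non-symmetric generating product contributes to `E` a plane exchanged by `op` with its
opposite, a commutative (anti-commutative) one contributes a line on which `op` is `1` (`-1`). The
presented operad is `BQOperad.operad`. -/
structure BQOperad (K : Type u) [Field K] where
  E : Type u
  [addCommGroup : AddCommGroup E]
  [module : Module K E]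
  [finite : FiniteDimensional K E]
  op : E →ₗ[K] E
  op_op : ∀ e, op (op e) = e
  rel : Set (FreeOps K E (Fin 3))

attribute [instance] BQOperad.addCommGroup BQOperad.module BQOperad.finite

variable {K : Type u} [Field K] (O : BQOperad K)

/-- Algebra structures on `V` of the type given by a presentation. -/
structure BQOperad.IsAlgebra {V : Type u} [AddCommGroup V] [Module K V]
    (m : BinOps K O.E V) : Prop where
  op : ∀ e x y, m (O.op e) x y = m e y x
  rel : ∀ r ∈ O.rel, ∀ v : Fin 3 → V, evalFree m v r = 0

/-- The multilinear identities that hold in all algebras of the given type. -/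
def BQOperad.identities (A : Type) : Submodule K (FreeOps K O.E A) where
  carrier := {p | ∀ (V : Type u) [AddCommGroup V] [Module K V] (m : BinOps K O.E V),
    O.IsAlgebra m → ∀ v : A → V, evalFree m v p = 0}
  add_mem' hp hq V _ _ m hm v := by rw [map_add, hp V m hm, hq V m hm, add_zero]
  zero_mem' V _ _ m hm v := map_zero _
  smul_mem' c p hp V _ _ m hm v := by rw [map_smul, hp V m hm, smul_zero]

/-- The operations with set of inputs `A` in the presented operad: the linear combinations of
multilinear monomials with variables in `A`, modulo those that vanish identically in all algebras of
the given type. This is the multilinear part of the free algebra on `A`. -/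
abbrev BQOperad.Ops (A : Type) : Type u := FreeOps K O.E A ⧸ O.identities A

variable {O} {A B C : Type} {V : Type u} [AddCommGroup V] [Module K V]

/-- The value of an operation in an algebra. -/
noncomputable def BQOperad.Ops.eval {m : BinOps K O.E V} (hm : O.IsAlgebra m) (v : A → V) :
    O.Ops A →ₗ[K] V :=
  (O.identities A).liftQ (evalFree m v) fun _ hp => hp V m hm v

theorem BQOperad.Ops.ext {p q : O.Ops A}
    (h : ∀ (V : Type u) [AddCommGroup V] [Module K V] (m : BinOps K O.E V) (hm : O.IsAlgebra m)
      (v : A → V), Ops.eval hm v p = Ops.eval hm v q) : p = q := by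
  obtain ⟨p, rfl⟩ := Submodule.Quotient.mk_surjective _ p
  obtain ⟨q, rfl⟩ := Submodule.Quotient.mk_surjective _ q
  rw [Submodule.Quotient.eq]
  intro V _ _ m hm v
  rw [map_sub, sub_eq_zero]
  exact h V m hm v

variable (O) in
/-- The identity operation. -/
noncomputable def BQOperad.Ops.one : O.Ops Unit :=
  Submodule.Quotient.mk (Finsupp.single ⟨.leaf (), by simp [Tree.IsMultilinear, Tree.leaves]⟩ 1)

/-- Renaming of the inputs. -/
noncomputable def BQOperad.Ops.map (σ : A ≃ B) : O.Ops A →ₗ[K] O.Ops B :=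
  (O.identities A).mapQ (O.identities B) (FreeOps.map σ) fun p hp V _ _ m hm v => by
    rw [evalFree_map]
    exact hp V m hm _

/-- Insertion of an operation into the input `none`. -/
noncomputable def BQOperad.Ops.comp : O.Ops (Option A) →ₗ[K] O.Ops B →ₗ[K] O.Ops (A ⊕ B) :=
  (O.identities (Option A)).liftQ
    (LinearMap.mk₂ K
      (fun p q => (O.identities B).mapQ (O.identities (A ⊕ B)) (FreeOps.comp p)
        (fun q hq V _ _ m hm v => by
          classical
          rw [evalFree_comp, hq V m hm, ← evalMulti_apply]
          exact (evalMulti m p).map_coord_zero none rfl) q)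
      (fun p p' q => by
        obtain ⟨q, rfl⟩ := Submodule.Quotient.mk_surjective _ q
        exact congrArg Submodule.Quotient.mk (LinearMap.map_add₂ FreeOps.comp p p' q))
      (fun c p q => by
        obtain ⟨q, rfl⟩ := Submodule.Quotient.mk_surjective _ q
        exact congrArg Submodule.Quotient.mk (LinearMap.map_smul₂ FreeOps.comp c p q))
      (fun p q q' => by simp)
      (fun c p q => by simp))
    (fun p hp => by
      rw [LinearMap.mem_ker]
      refine LinearMap.ext fun q => ?_
      obtain ⟨q, rfl⟩ := Submodule.Quotient.mk_surjective _ q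
      refine (Submodule.Quotient.mk_eq_zero _).2 fun V _ _ m hm v => ?_
      rw [evalFree_comp]
      exact hp V m hm _)

section

variable {m : BinOps K O.E V} (hm : O.IsAlgebra m)

theorem BQOperad.Ops.eval_mk (v : A → V) (p : FreeOps K O.E A) :
    Ops.eval hm v (Submodule.Quotient.mk p) = evalFree m v p := rfl

theorem BQOperad.Ops.eval_one (v : Unit → V) : Ops.eval hm v (Ops.one O) = v () := by
  rw [Ops.one, eval_mk, evalFree_single, one_smul]
  rfl

theorem BQOperad.Ops.eval_map (σ : A ≃ B) (v : B → V) (p : O.Ops A) :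
    Ops.eval hm v (Ops.map σ p) = Ops.eval hm (fun a => v (σ a)) p := by
  obtain ⟨p, rfl⟩ := Submodule.Quotient.mk_surjective _ p
  exact evalFree_map m v σ p

theorem BQOperad.Ops.eval_comp (v : A ⊕ B → V) (p : O.Ops (Option A)) (q : O.Ops B) :
    Ops.eval hm v (Ops.comp p q) =
      Ops.eval hm (fun o => o.elim (Ops.eval hm (fun b => v (Sum.inr b)) q)
        fun a => v (Sum.inl a)) p := by
  obtain ⟨p, rfl⟩ := Submodule.Quotient.mk_surjective _ p
  obtain ⟨q, rfl⟩ := Submodule.Quotient.mk_surjective _ q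
  exact evalFree_comp m v p q

end

variable (O) in
/-- The operad given by a finite binary quadratic presentation. -/
noncomputable def BQOperad.operad : SymmetricOperad K where
  obj A _ := O.Ops A
  map σ := Ops.map σ
  one := Ops.one O
  comp := Ops.comp
  map_refl p := Ops.ext fun V _ _ m hm v => by simp [Ops.eval_map]
  map_trans σ τ p := Ops.ext fun V _ _ m hm v => by simp [Ops.eval_map]
  comp_map σ τ p q := Ops.ext fun V _ _ m hm v => by
    simp only [Ops.eval_map, Ops.eval_comp]
    congr 1
    congr 1
    funext o
    cases o <;> simp
  one_comp q := Ops.ext fun V _ _ m hm v => by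
    simp only [Ops.eval_map, Ops.eval_comp, Ops.eval_one]
    rfl
  comp_one p := Ops.ext fun V _ _ m hm v => by
    simp only [Ops.eval_map, Ops.eval_comp, Ops.eval_one]
    congr 1
    congr 1
    funext o
    cases o <;> simp
  comp_comp p q r := Ops.ext fun V _ _ m hm v => by
    simp only [Ops.eval_map, Ops.eval_comp]
    congr 1
    congr 1
    funext o
    cases o with
    | some a => rfl
    | none =>
      simp only [rightOption, Option.elim, Equiv.coe_fn_mk, Sum.elim_inr]
      congr 1
      congr 1
      funext o
      cases o <;> rfl
  comp_right_comm p q r := Ops.ext fun V _ _ m hm v => by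
    simp only [Ops.eval_map, Ops.eval_comp]
    congr 1
    congr 1
    funext o
    rcases o with _ | _ | a <;> rfl

end Presentations

section Category

open BQOperad

variable {K : Type u} [Field K]

/-- The category of finitely generated binary quadratic operads: the objects are the presented
operads, and the morphisms are all morphisms of operads. -/
noncomputable instance : Category (BQOperad K) where
  Hom O P := O.operad ⟶ P.operad
  id O := 𝟙 O.operad
  comp f g := CategoryStruct.comp (obj := SymmetricOperad K) f g
  id_comp f := Category.id_comp (obj := SymmetricOperad K) f
  comp_id f := Category.comp_id (obj := SymmetricOperad K) f
  assoc f g h := Category.assoc (obj := SymmetricOperad K) f g h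

/-- The action of a morphism on the operations with set of inputs `A`. -/
noncomputable def BQOperad.apply {O P : BQOperad K} (φ : O ⟶ P) (A : Type) [Finite A] :
    O.Ops A →ₗ[K] P.Ops A :=
  SymmetricOperad.Hom.app φ A

variable {O P Q : BQOperad K} {A B : Type} {V : Type u} [AddCommGroup V] [Module K V]

theorem BQOperad.apply_map [Finite A] [Finite B] (φ : O ⟶ P) (σ : A ≃ B) (p : O.Ops A) :
    apply φ B (Ops.map σ p) = Ops.map σ (apply φ A p) :=
  SymmetricOperad.Hom.app_map φ σ p

theorem BQOperad.apply_comp [Finite A] [Finite B] (φ : O ⟶ P) (p : O.Ops (Option A))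
    (q : O.Ops B) :
    apply φ (A ⊕ B) (Ops.comp p q) = Ops.comp (apply φ (Option A) p) (apply φ B q) :=
  SymmetricOperad.Hom.app_comp φ p q

/-- The monomial given by a generating operation. -/
def genMono {E : Type u} (e : E) : Mono E (Fin 2) :=
  ⟨.node e (.leaf 0) (.leaf 1), by
    constructor
    · simp [Tree.leaves]
    · intro a; fin_cases a <;> simp [Tree.leaves]⟩

variable (O) in
/-- A generating operation, as an operation with two inputs. -/
noncomputable def BQOperad.gen : O.E →ₗ[K] O.Ops (Fin 2) where
  toFun e := Submodule.Quotient.mk (Finsupp.single (genMono e) 1)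
  map_add' e e' := Ops.ext fun V _ _ m hm v => by
    simp [Ops.eval_mk, evalFree_single, genMono, Tree.eval]
  map_smul' c e := Ops.ext fun V _ _ m hm v => by
    simp [Ops.eval_mk, evalFree_single, genMono, Tree.eval]

theorem BQOperad.eval_gen {m : BinOps K O.E V} (hm : O.IsAlgebra m) (v : Fin 2 → V) (e : O.E) :
    Ops.eval hm v (O.gen e) = m e (v 0) (v 1) := by
  refine (evalFree_single m v (genMono e) 1).trans ?_
  rw [one_smul]
  rfl

theorem BQOperad.gen_op (e : O.E) : O.gen (O.op e) = Ops.map (Equiv.swap 0 1) (O.gen e) :=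
  Ops.ext fun V _ _ m hm v => by simp [Ops.eval_map, eval_gen, hm.op]

theorem Tree.length_pos {E : Type u} (t : Tree E A) : 0 < t.leaves.length := by
  induction t with
  | leaf a => simp [Tree.leaves]
  | node e s t hs ht => simp [Tree.leaves]; omega

theorem Tree.eq_leaf {E : Type u} (t : Tree E A) (h : t.leaves.length ≤ 1) :
    ∃ a, t = .leaf a := by
  cases t with
  | leaf a => exact ⟨a, rfl⟩
  | node e s t =>
    have hs := s.length_pos
    have ht := t.length_pos
    simp [Tree.leaves] at h
    omega

theorem Tree.IsMultilinear.length {E : Type u} {n : ℕ} {t : Tree E (Fin n)}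
    (h : t.IsMultilinear) : t.leaves.length = n := by
  have h1 := List.toFinset_card_of_nodup h.1
  have h2 : t.leaves.toFinset = Finset.univ := by
    ext a; simp [h.2 a]
  rw [← h1, h2, Finset.card_univ, Fintype.card_fin]

theorem Tree.eq_node {E : Type u} (t : Tree E A) (h : t.leaves.length = 2) :
    ∃ e a b, t = .node e (.leaf a) (.leaf b) := by
  cases t with
  | leaf a => simp [Tree.leaves] at h
  | node e s t =>
    have hs := s.length_pos
    have ht := t.length_pos
    simp [Tree.leaves] at h
    obtain ⟨a, rfl⟩ := s.eq_leaf (by omega)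
    obtain ⟨b, rfl⟩ := t.eq_leaf (by omega)
    exact ⟨e, a, b, rfl⟩

theorem Tree.eq_node₃ {E : Type u} (t : Tree E A) (h : t.leaves.length = 3) :
    (∃ e e' a b c, t = .node e (.node e' (.leaf a) (.leaf b)) (.leaf c)) ∨
      ∃ e e' a b c, t = .node e (.leaf a) (.node e' (.leaf b) (.leaf c)) := by
  cases t with
  | leaf a => simp [Tree.leaves] at h
  | node e s t =>
    have hs := s.length_pos
    have ht := t.length_pos
    simp [Tree.leaves] at h
    rcases (by omega : s.leaves.length = 2 ∧ t.leaves.length ≤ 1 ∨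
      s.leaves.length ≤ 1 ∧ t.leaves.length = 2) with ⟨h1, h2⟩ | ⟨h1, h2⟩
    · obtain ⟨e', a, b, rfl⟩ := s.eq_node h1
      obtain ⟨c, rfl⟩ := t.eq_leaf h2
      exact Or.inl ⟨e, e', a, b, c, rfl⟩
    · obtain ⟨a, rfl⟩ := s.eq_leaf h1
      obtain ⟨e', b, c, rfl⟩ := t.eq_node h2
      exact Or.inr ⟨e, e', a, b, c, rfl⟩

variable (O) in
/-- The free two step nilpotent algebra on two generators. -/
def BQOperad.nilOps : BinOps K O.E ((Fin 2 → K) × O.E) :=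
  LinearMap.mk₂ K
    (fun e x =>
      { toFun := fun y => (0, (x.1 0 * y.1 1) • e + (x.1 1 * y.1 0) • O.op e)
        map_add' := fun y y' => by
          ext1
          · simp
          · simp; module
        map_smul' := fun c y => by
          ext1
          · simp
          · simp; module })
    (fun e e' x => LinearMap.ext fun y => by
      ext1
      · simp
      · simp; module)
    (fun c e x => LinearMap.ext fun y => by
      ext1
      · simp
      · simp; module)
    (fun e x x' => LinearMap.ext fun y => by
      ext1
      · simp
      · simp; module)
    (fun c e x => LinearMap.ext fun y => by
      ext1
      · simp
      · simp; module)

theorem BQOperad.nilOps_apply (e : O.E) (x y : (Fin 2 → K) × O.E) :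
    O.nilOps e x y = (0, (x.1 0 * y.1 1) • e + (x.1 1 * y.1 0) • O.op e) := rfl

theorem BQOperad.nilOps_isAlgebra : O.IsAlgebra O.nilOps where
  op e x y := by simp [nilOps_apply, O.op_op, mul_comm, add_comm]
  rel r hr v := by
    rw [evalFree, Finsupp.linearCombination_apply]
    refine Finset.sum_eq_zero fun t _ => ?_
    obtain ⟨t, ht⟩ := t
    rcases t.eq_node₃ ht.length with ⟨e, e', a, b, c, rfl⟩ | ⟨e, e', a, b, c, rfl⟩ <;>
      simp [Tree.eval, nilOps_apply]

theorem BQOperad.gen_injective : Function.Injective O.gen := by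
  intro e e' h
  have := congrArg (Ops.eval O.nilOps_isAlgebra fun i : Fin 2 => (Pi.single i 1, 0)) h
  simpa [eval_gen, nilOps_apply] using this

theorem BQOperad.gen_surjective : Function.Surjective O.gen := by
  intro p
  obtain ⟨p, rfl⟩ := Submodule.Quotient.mk_surjective _ p
  induction p using Finsupp.induction_linear with
  | zero => exact ⟨0, map_zero _⟩
  | add p q hp hq =>
    obtain ⟨e, he⟩ := hp
    obtain ⟨e', he'⟩ := hq
    exact ⟨e + e', by rw [map_add, he, he']; rfl⟩
  | single t c =>
    obtain ⟨t, ht⟩ := t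
    obtain ⟨e, a, b, rfl⟩ := t.eq_node ht.length
    have hab := ht.1
    simp only [Tree.leaves, List.cons_append, List.nil_append, List.nodup_cons,
      List.mem_singleton] at hab
    have h : (a = 0 ∧ b = 1) ∨ (a = 1 ∧ b = 0) := by
      have := hab.1
      clear hab ht
      revert a b
      decide
    rcases h with ⟨rfl, rfl⟩ | ⟨rfl, rfl⟩
    · refine ⟨c • e, Ops.ext fun V _ _ m hm v => ?_⟩
      simp [eval_gen, Ops.eval_mk, evalFree_single, Tree.eval]
    · refine ⟨c • O.op e, Ops.ext fun V _ _ m hm v => ?_⟩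
      simp [eval_gen, Ops.eval_mk, evalFree_single, Tree.eval, hm.op]

variable (O) in
/-- The generating operations are all the operations with two inputs. -/
noncomputable def BQOperad.genEquiv : O.E ≃ₗ[K] O.Ops (Fin 2) :=
  LinearEquiv.ofBijective O.gen ⟨gen_injective, gen_surjective⟩

/-- The action of a morphism on the generating operations. -/
noncomputable def BQOperad.onGen (φ : O ⟶ P) : O.E →ₗ[K] P.E :=
  P.genEquiv.symm.toLinearMap ∘ₗ apply φ (Fin 2) ∘ₗ O.gen

theorem BQOperad.gen_onGen (φ : O ⟶ P) (e : O.E) :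
    P.gen (onGen φ e) = apply φ (Fin 2) (O.gen e) :=
  P.genEquiv.apply_symm_apply _

theorem BQOperad.onGen_id (O : BQOperad K) : onGen (𝟙 O) = LinearMap.id :=
  LinearMap.ext fun e => gen_injective (gen_onGen (𝟙 O) e)

theorem BQOperad.onGen_comp (φ : O ⟶ P) (ψ : P ⟶ Q) :
    onGen (φ ≫ ψ) = onGen ψ ∘ₗ onGen φ :=
  LinearMap.ext fun e => gen_injective <| by
    rw [gen_onGen, LinearMap.comp_apply, gen_onGen, gen_onGen]
    rfl

theorem BQOperad.onGen_op (φ : O ⟶ P) (e : O.E) : onGen φ (O.op e) = P.op (onGen φ e) :=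
  gen_injective <| by rw [gen_onGen, gen_op, apply_map, gen_op, gen_onGen]

/-- A triple of distinct elements of `Fin 3` as a bijection. -/
noncomputable def tripleEquiv (a b c : Fin 3) (h : [a, b, c].Nodup) : Unit ⊕ Fin 2 ≃ Fin 3 :=
  Equiv.ofBijective (Sum.elim (fun _ => a) ![b, c]) <| by
    revert a b c
    decide

/-- The bijection sending the first input to the marked one. -/
def markFirst : Fin 2 ≃ Option Unit where
  toFun := ![none, some ()]
  invFun o := o.elim 0 fun _ => 1
  left_inv i := by fin_cases i <;> rfl
  right_inv := by rintro (_ | _) <;> rfl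

theorem BQOperad.eval_apply_single {m : BinOps K P.E V} (hm : P.IsAlgebra m) (φ : O ⟶ P)
    (v : Fin 3 → V) (t : Mono O.E (Fin 3)) :
    Ops.eval hm v (apply φ (Fin 3) (Submodule.Quotient.mk (Finsupp.single t 1))) =
      t.1.eval (m ∘ₗ onGen φ) v := by
  obtain ⟨t, ht⟩ := t
  have key : ∀ (e e' : O.E) (a b c : Fin 3) (h : [c, a, b].Nodup),
      Ops.eval hm v (apply φ (Fin 3) (Ops.map (tripleEquiv c a b h)
        (Ops.comp (Ops.map markFirst (O.gen e)) (O.gen e')))) =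
      m (onGen φ e) (m (onGen φ e') (v a) (v b)) (v c) := by
    intro e e' a b c h
    rw [apply_map, apply_comp, apply_map, ← gen_onGen, ← gen_onGen]
    simp only [Ops.eval_map, Ops.eval_comp, eval_gen]
    rfl
  rcases t.eq_node₃ ht.length with ⟨e, e', a, b, c, rfl⟩ | ⟨e, e', a, b, c, rfl⟩
  · have h : [c, a, b].Nodup := by
      have := ht.1
      simp only [Tree.leaves, List.cons_append, List.nil_append] at this
      clear ht
      revert a b c; decide
    refine Eq.trans ?_ (key e e' a b c h)
    congr 2
    refine Ops.ext fun V _ _ m hm v => ?_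
    simp only [Ops.eval_map, Ops.eval_comp, eval_gen, Ops.eval_mk, evalFree_single, one_smul]
    rfl
  · have h : [a, b, c].Nodup := by
      have := ht.1
      simp only [Tree.leaves, List.cons_append, List.nil_append] at this
      clear ht
      revert a b c; decide
    refine Eq.trans ?_ ((key (O.op e) e' b c a h).trans ?_)
    · congr 2
      refine Ops.ext fun V _ _ m hm v => ?_
      simp only [Ops.eval_map, Ops.eval_comp, eval_gen, Ops.eval_mk, evalFree_single, one_smul,
        hm.op]
      rfl
    · rw [onGen_op, hm.op]
      rfl

/-- Algebra structures are pulled back along morphisms of operads. -/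
theorem BQOperad.IsAlgebra.pullback {m : BinOps K P.E V} (hm : P.IsAlgebra m) (φ : O ⟶ P) :
    O.IsAlgebra (m ∘ₗ onGen φ) where
  op e x y := by simp [onGen_op, hm.op]
  rel r hr v := by
    have h0 : (Submodule.Quotient.mk r : O.Ops (Fin 3)) = 0 :=
      (Submodule.Quotient.mk_eq_zero _).2 fun V _ _ m hm v => hm.rel r hr v
    have h1 : ∀ r : FreeOps K O.E (Fin 3),
        Ops.eval hm v (apply φ (Fin 3) (Submodule.Quotient.mk r)) =
          evalFree (m ∘ₗ onGen φ) v r := by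
      intro r
      induction r using Finsupp.induction_linear with
      | zero => rw [Submodule.Quotient.mk_zero]; simp
      | add p q hp hq => rw [Submodule.Quotient.mk_add, map_add, map_add, hp, hq, map_add]
      | single t c =>
        have : (Finsupp.single t c : FreeOps K O.E (Fin 3)) = c • Finsupp.single t 1 := by simp
        rw [this, Submodule.Quotient.mk_smul, map_smul, map_smul, eval_apply_single, map_smul,
          evalFree_single, one_smul]
    rw [← h1, h0, map_zero, map_zero]

/-- The maps on operations induced by a linear map between the spaces of generating operations along
which algebra structures can be pulled back. -/
noncomputable def BQOperad.liftApp (f : O.E →ₗ[K] P.E)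
    (hf : ∀ (V : Type u) [AddCommGroup V] [Module K V] (m : BinOps K P.E V),
      P.IsAlgebra m → O.IsAlgebra (m ∘ₗ f)) (A : Type) : O.Ops A →ₗ[K] P.Ops A :=
  (O.identities A).mapQ (P.identities A) (FreeOps.mapOps f) fun p hp V _ _ m hm v => by
    rw [evalFree_mapOps]
    exact hp V _ (hf V m hm) v

theorem BQOperad.eval_liftApp (f : O.E →ₗ[K] P.E)
    (hf : ∀ (V : Type u) [AddCommGroup V] [Module K V] (m : BinOps K P.E V),
      P.IsAlgebra m → O.IsAlgebra (m ∘ₗ f)) {m : BinOps K P.E V} (hm : P.IsAlgebra m)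
    (v : A → V) (p : O.Ops A) :
    Ops.eval hm v (liftApp f hf A p) = Ops.eval (hf V m hm) v p := by
  obtain ⟨p, rfl⟩ := Submodule.Quotient.mk_surjective _ p
  exact evalFree_mapOps m v f p

theorem BQOperad.liftApp_comp (f : O.E →ₗ[K] P.E)
    (hf : ∀ (V : Type u) [AddCommGroup V] [Module K V] (m : BinOps K P.E V),
      P.IsAlgebra m → O.IsAlgebra (m ∘ₗ f)) (p : O.Ops (Option A)) (q : O.Ops B) :
    liftApp f hf (A ⊕ B) (Ops.comp p q) =
      Ops.comp (liftApp f hf (Option A) p) (liftApp f hf B q) :=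
  Ops.ext fun V _ _ m hm v => by simp only [eval_liftApp, Ops.eval_comp]

/-- A linear map between the spaces of generating operations along which algebra structures can be
pulled back defines a morphism of operads. -/
noncomputable def BQOperad.lift (f : O.E →ₗ[K] P.E)
    (hf : ∀ (V : Type u) [AddCommGroup V] [Module K V] (m : BinOps K P.E V),
      P.IsAlgebra m → O.IsAlgebra (m ∘ₗ f)) : O ⟶ P :=
  SymmetricOperad.Hom.mk (P := O.operad) (Q := P.operad) (fun A _ => liftApp f hf A)
    (fun _ p => Ops.ext fun _ _ _ _ hm v =>
      (eval_liftApp f hf hm v _).trans <| (Ops.eval_map _ _ _ _).trans <|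
        (eval_liftApp f hf hm _ p).symm.trans (Ops.eval_map _ _ _ _).symm)
    (Ops.ext fun _ _ _ _ hm v =>
      (eval_liftApp f hf hm v _).trans <| (Ops.eval_one _ _).trans (Ops.eval_one _ _).symm)
    (fun p q => liftApp_comp f hf p q)

theorem BQOperad.eval_lift (f : O.E →ₗ[K] P.E)
    (hf : ∀ (V : Type u) [AddCommGroup V] [Module K V] (m : BinOps K P.E V),
      P.IsAlgebra m → O.IsAlgebra (m ∘ₗ f)) [Finite A] {m : BinOps K P.E V} (hm : P.IsAlgebra m)
    (v : A → V) (p : O.Ops A) :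
    Ops.eval hm v (apply (lift f hf) A p) = Ops.eval (hf V m hm) v p :=
  eval_liftApp f hf hm v p

theorem BQOperad.hom_ext_apply {φ ψ : O ⟶ P}
    (h : ∀ (A : Type) [Finite A] (p : O.Ops A), apply φ A p = apply ψ A p) : φ = ψ := by
  refine SymmetricOperad.Hom.ext ?_
  funext A _
  exact LinearMap.ext fun p => h A p

end Category

section Cochains

/-- A cochain complex of finite rank with a product, in terms of a basis `I` of homogeneous cochains:
`bd i k` is the coefficient of `k` in the differential of `i`, and `cup i j k` is the coefficient of
`k` in the product of `i` and `j`. Two of the basis cochains are given names. -/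
structure CochainModel (I : Type) where
  deg : I → ℕ
  bd : I → I → ℤ
  cup : I → I → I → ℤ
  right : I
  edge : I

/-- The cells of the standard `1`-simplex. -/
inductive Cell
  | left
  | right
  | edge
  deriving DecidableEq

instance : Fintype Cell := ⟨{.left, .right, .edge}, by rintro (_ | _ | _) <;> simp⟩

/-- The cells of the standard `1`-simplex other than its left vertex. -/
inductive RelCell
  | right
  | edge
  deriving DecidableEq

instance : Fintype RelCell := ⟨{.right, .edge}, by rintro (_ | _) <;> simp⟩

/-- The cochains on the standard `1`-simplex with the cup product. -/
def interval : CochainModel Cell where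
  deg
    | .edge => 1
    | _ => 0
  bd
    | .left, .edge => -1
    | .right, .edge => 1
    | _, _ => 0
  cup
    | .left, .left, .left => 1
    | .right, .right, .right => 1
    | .left, .edge, .edge => 1
    | .edge, .right, .edge => 1
    | _, _, _ => 0
  right := .right
  edge := .edge

/-- The cochains on the standard `1`-simplex relative to its left vertex, with the cup product. -/
def relInterval : CochainModel RelCell where
  deg
    | .edge => 1
    | _ => 0
  bd
    | .right, .edge => 1
    | _, _ => 0
  cup
    | .right, .right, .right => 1
    | .edge, .right, .edge => 1
    | _, _, _ => 0
  right := .right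
  edge := .edge

namespace CochainModel

variable {K : Type u} [Field K] {I : Type} [Fintype I] [DecidableEq I] (D : CochainModel I)
  {E E' E'' : Type u} [AddCommGroup E] [Module K E]
  [AddCommGroup E'] [Module K E'] [AddCommGroup E''] [Module K E'']
  {V : Type u} [AddCommGroup V] [Module K V] {A : Type}

/-- Cochains with coefficients in `V`. -/
abbrev Cochain (_ : CochainModel I) (V : Type u) : Type u := I → V

/-- The differential. -/
def d (α : D.Cochain V) : D.Cochain V := fun k => ∑ i, D.bd i k • α i

/-- Structure constants of the opposite product, with the Koszul sign. -/
def cupOp (i j k : I) : ℤ := (-1) ^ (D.deg i * D.deg j) * D.cup j i k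

/-- Structure constants of the graded commutator. -/
def bracket (i j k : I) : ℤ := D.cup i j k - D.cupOp i j k

/-- The operations on cochains with coefficients in `V` for which the `k`-component of the value of
`e` on `α` and `β` is the sum over `i` and `j` of the values of `c i j k e` on `α i` and `β j`. -/
def ops (c : I → I → I → E' →ₗ[K] E) (m : BinOps K E V) : BinOps K E' (D.Cochain V) :=
  LinearMap.mk₂ K
    (fun e α => LinearMap.pi fun k => ∑ i, ∑ j, m (c i j k e) (α i) ∘ₗ LinearMap.proj j)
    (fun e e' α => by ext; simp [Finset.sum_add_distrib])
    (fun x e α => by ext; simp [Finset.smul_sum])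
    (fun e α α' => by ext; simp [Finset.sum_add_distrib])
    (fun x e α => by ext; simp [Finset.smul_sum])

theorem ops_apply (c : I → I → I → E' →ₗ[K] E) (m : BinOps K E V) (e : E')
    (α β : D.Cochain V) (k : I) :
    D.ops c m e α β k = ∑ i, ∑ j, m (c i j k e) (α i) (β j) := by
  simp [ops]

theorem ops_single (c : I → I → I → E' →ₗ[K] E) (m : BinOps K E V) (e : E')
    (i j k : I) (x y : V) :
    D.ops c m e (Pi.single i x) (Pi.single j y) k = m (c i j k e) x y := by
  rw [ops_apply, Finset.sum_eq_single i, Finset.sum_eq_single j]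
  · simp
  · intro j' _ hj
    simp [Pi.single_eq_of_ne hj]
  · simp
  · intro i' _ hi
    simp [Pi.single_eq_of_ne hi]
  · simp

theorem ops_comp (c : I → I → I → E' →ₗ[K] E) (m : BinOps K E V) (f : E'' →ₗ[K] E') :
    D.ops (fun i j k => c i j k ∘ₗ f) m = D.ops c m ∘ₗ f :=
  LinearMap.ext₂ fun e α => LinearMap.ext fun β => funext fun k => by simp [ops_apply]

theorem ops_comp' (c : I → I → I → E'' →ₗ[K] E') (m : BinOps K E V) (f : E' →ₗ[K] E) :
    D.ops (fun i j k => f ∘ₗ c i j k) m = D.ops c (m ∘ₗ f) :=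
  LinearMap.ext₂ fun e α => LinearMap.ext fun β => funext fun k => by simp [ops_apply]

theorem exists_expand_tree (c : I → I → I → E' →ₗ[K] E) (l : A → I) (t : Tree E' A)
    (k : I) : ∃ r : {s : Tree E A // s.leaves = t.leaves} →₀ K,
      ∀ (V : Type u) [AddCommGroup V] [Module K V] (m : BinOps K E V) (x : A → V),
        t.eval (D.ops c m) (fun a => Pi.single (l a) (x a)) k =
          Finsupp.linearCombination K (fun s => s.1.eval m x) r := by
  induction t generalizing k with
  | leaf a =>
    by_cases h : l a = k
    · refine ⟨Finsupp.single ⟨.leaf a, rfl⟩ 1, fun V _ _ m x => ?_⟩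
      subst h
      simp [Tree.eval]
    · refine ⟨0, fun V _ _ m x => ?_⟩
      simp [Tree.eval, Pi.single_eq_of_ne (Ne.symm h)]
  | node e s t hs ht =>
    choose p hp using hs
    choose q hq using ht
    refine ⟨∑ i, ∑ j, ∑ a ∈ (p i).support, ∑ b ∈ (q j).support,
      Finsupp.single ⟨.node (c i j k e) a.1 b.1, by simp [Tree.leaves, a.2, b.2]⟩
        (p i a * q j b), fun V _ _ m x => ?_⟩
    simp only [Tree.eval, ops_apply, map_sum, Finsupp.linearCombination_single]
    refine Finset.sum_congr rfl fun i _ => Finset.sum_congr rfl fun j _ => ?_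
    rw [hp i V m x, hq j V m x]
    simp only [Finsupp.linearCombination_apply, Finsupp.sum, map_sum, LinearMap.sum_apply,
      map_smul, LinearMap.smul_apply, Finset.smul_sum, smul_smul]
    rw [Finset.sum_comm]
    refine Finset.sum_congr rfl fun a _ => Finset.sum_congr rfl fun b _ => ?_
    rw [mul_comm]

theorem exists_expand (c : I → I → I → E' →ₗ[K] E) (l : A → I) (p : FreeOps K E' A)
    (k : I) : ∃ r : FreeOps K E A,
      ∀ (V : Type u) [AddCommGroup V] [Module K V] (m : BinOps K E V) (x : A → V),
        evalFree (D.ops c m) (fun a => Pi.single (l a) (x a)) p k = evalFree m x r := by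
  induction p using Finsupp.induction_linear with
  | zero => exact ⟨0, fun V _ _ m x => by simp⟩
  | add p q hp hq =>
    obtain ⟨r, hr⟩ := hp
    obtain ⟨s, hs⟩ := hq
    exact ⟨r + s, fun V _ _ m x => by rw [map_add, map_add, Pi.add_apply, hr, hs]⟩
  | single t a =>
    obtain ⟨r, hr⟩ := D.exists_expand_tree c l t.1 k
    refine ⟨a • Finsupp.mapDomain (fun s => ⟨s.1, by
      have := t.2
      unfold Tree.IsMultilinear at this ⊢
      rwa [s.2]⟩) r, fun V _ _ m x => ?_⟩
    rw [evalFree_single, map_smul, Pi.smul_apply, hr V m x, evalFree,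
      Finsupp.linearCombination_mapDomain]
    rfl

/-- If an identity holds for homogeneous basis cochains, then it holds for all cochains. -/
theorem evalFree_eq_zero [Finite A] {M : BinOps K E (D.Cochain V)} {r : FreeOps K E A}
    (h : ∀ (l : A → I) (x : A → V) (k : I),
      evalFree M (fun a => Pi.single (l a) (x a)) r k = 0) (v : A → D.Cochain V) :
    evalFree M v r = 0 := by
  classical
  cases nonempty_fintype A
  have hv : v = fun a => ∑ i, Pi.single i (v a i) := by
    funext a
    exact (Finset.univ_sum_single (v a)).symm
  rw [hv, ← evalMulti_apply, MultilinearMap.map_sum]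
  refine Finset.sum_eq_zero fun l _ => ?_
  rw [evalMulti_apply]
  exact funext fun k => h l _ k

end CochainModel

end Cochains

section Functors

variable {K : Type u} [Field K] {I : Type} [Fintype I] [DecidableEq I] (D : CochainModel I)
  {O P : BQOperad K} {V : Type u} [AddCommGroup V] [Module K V]

open CochainModel

/-- Local dg algebra structures on the cochains with coefficients in `V`. The degrees of the cochains
are `0` and `1`, so that, by `degree`, a product of monomials vanishes as soon as two of the
factors have degree `1`; therefore no Koszul signs occur in the conditions in `isAlgebra`. The last
condition says that, for every set `X` of vertices, the cochains relative to `X` form an ideal. -/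
structure CochainModel.IsLocalDG (O : BQOperad K) (M : BinOps K O.E (D.Cochain V)) : Prop where
  isAlgebra : O.IsAlgebra M
  degree : ∀ e i j k x y, D.deg k ≠ D.deg i + D.deg j →
    M e (Pi.single i x) (Pi.single j y) k = 0
  leibniz : ∀ e i x (β : D.Cochain V), D.d (M e (Pi.single i x) β) =
    M e (D.d (Pi.single i x)) β + (-1 : ℤ) ^ D.deg i • M e (Pi.single i x) (D.d β)
  isLocal : ∀ X : Set I, (∀ i ∈ X, D.deg i = 0) → ∀ e (α β : D.Cochain V),
    (∀ i ∈ X, α i = 0) → (∀ i ∈ X, M e α β i = 0) ∧ ∀ i ∈ X, M e β α i = 0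

variable {E : Type u} [AddCommGroup E] [Module K E]

/-- The products of an edge cochain with a cochain at the right vertex, as operations on `V`. -/
def CochainModel.under (M : BinOps K E (D.Cochain V)) : BinOps K E V :=
  LinearMap.mk₂ K
    (fun e x => LinearMap.proj D.edge ∘ₗ M e (Pi.single D.edge x) ∘ₗ LinearMap.single K (fun _ => V) D.right)
    (fun e e' x => by ext; simp)
    (fun c e x => by ext; simp)
    (fun e x x' => by ext; simp [Pi.single_add])
    (fun c e x => by ext; simp [Pi.single_smul])

/-- The products of a cochain at the right vertex with an edge cochain, as operations on `V`. -/
def CochainModel.over (M : BinOps K E (D.Cochain V)) : BinOps K E V :=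
  LinearMap.mk₂ K
    (fun e x => LinearMap.proj D.edge ∘ₗ M e (Pi.single D.right x) ∘ₗ LinearMap.single K (fun _ => V) D.edge)
    (fun e e' x => by ext; simp)
    (fun c e x => by ext; simp)
    (fun e x x' => by ext; simp [Pi.single_add])
    (fun c e x => by ext; simp [Pi.single_smul])

theorem CochainModel.under_apply (M : BinOps K E (D.Cochain V)) (e : E) (x y : V) :
    D.under M e x y = M e (Pi.single D.edge x) (Pi.single D.right y) D.edge := rfl

theorem CochainModel.over_apply (M : BinOps K E (D.Cochain V)) (e : E) (x y : V) :
    D.over M e x y = M e (Pi.single D.right x) (Pi.single D.edge y) D.edge := rfl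

/-- Both families of operations on `V` together: `(a, b)` acts as the sum of `under M a` and
`over M b`. -/
def CochainModel.induced (M : BinOps K E (D.Cochain V)) : BinOps K (E × E) V :=
  (D.under M).coprod (D.over M)

theorem CochainModel.induced_apply (M : BinOps K E (D.Cochain V)) (a : E × E) (x y : V) :
    D.induced M a x y = D.under M a.1 x y + D.over M a.2 x y := by
  simp [induced]

/-- The tensor product operations on cochains with coefficients in an algebra `V`: the pair `(a, b)`
acts as the sum of the tensor product of the cup product with `a` and the tensor product of the
opposite cup product with `b`. -/
def CochainModel.cupOps (m : BinOps K E V) : BinOps K (E × E) (D.Cochain V) :=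
  D.ops (fun i j k => D.cup i j k • LinearMap.fst K E E + D.cupOp i j k • LinearMap.snd K E E) m

/-- The tensor product operations of the graded commutator of cochains with the operations on an
algebra `V`. -/
def CochainModel.bracketOps (m : BinOps K E V) : BinOps K E (D.Cochain V) :=
  D.ops (fun i j k => D.bracket i j k • LinearMap.id) m

/-- The exchange of the two summands, composed with a linear map on both of them. -/
def swapOp (f : E →ₗ[K] E) : E × E →ₗ[K] E × E :=
  (f ∘ₗ LinearMap.snd K E E).prod (f ∘ₗ LinearMap.fst K E E)

/-- The operad of which the algebra structures on `V` are the local dg `O`-algebra structures on the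
cochains with coefficients in `V`. The element `(a, b)` of the space of generating operations is the
sum of the operation `under` coming from `a` and the operation `over` coming from `b`. -/
abbrev BQOperad.black (O : BQOperad K) : BQOperad K where
  E := O.E × O.E
  op := swapOp O.op
  op_op e := by simp [swapOp, O.op_op]
  rel := {r | ∀ (V : Type u) [AddCommGroup V] [Module K V] (M : BinOps K O.E (D.Cochain V)),
    D.IsLocalDG O M → ∀ v : Fin 3 → V, evalFree (D.induced M) v r = 0}

/-- The operad with all the relations that hold for the tensor product operations on the cochains
with coefficients in an `O`-algebra. The element `(a, b)` of the space of generating operations is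
the sum of the cup product tensored with `a` and the opposite cup product tensored with `b`. -/
abbrev BQOperad.white (O : BQOperad K) : BQOperad K where
  E := O.E × O.E
  op := swapOp O.op
  op_op e := by simp [swapOp, O.op_op]
  rel := {r | ∀ (V : Type u) [AddCommGroup V] [Module K V] (m : BinOps K O.E V),
    O.IsAlgebra m → ∀ v : Fin 3 → D.Cochain V, evalFree (D.cupOps m) v r = 0}

/-- The associated `O`-algebra of a local dg `O`-algebra structure is trivial. -/
def CochainModel.TrivialAt (M : BinOps K E (D.Cochain V)) : Prop :=
  ∀ e x y, M e (Pi.single D.right x) (Pi.single D.right y) D.right = 0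

/-- The operad of which the algebra structures on `V` are the local dg `O`-algebra structures on the
cochains with coefficients in `V` with trivial associated `O`-algebra. -/
abbrev BQOperad.comBlack (O : BQOperad K) : BQOperad K where
  E := O.E
  op := -O.op
  op_op e := by simp [O.op_op]
  rel := {r | ∀ (V : Type u) [AddCommGroup V] [Module K V]
    (M : BinOps K O.E (interval.Cochain V)), interval.IsLocalDG O M → interval.TrivialAt M →
      ∀ v : Fin 3 → V, evalFree (interval.under M) v r = 0}

/-- The operad with all the relations that hold for the tensor products of the bracket of cochains
with the operations of an `O`-algebra. -/
abbrev BQOperad.lieWhite (O : BQOperad K) : BQOperad K where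
  E := O.E
  op := -O.op
  op_op e := by simp [O.op_op]
  rel := {r | ∀ (V : Type u) [AddCommGroup V] [Module K V] (m : BinOps K O.E V),
    O.IsAlgebra m → ∀ v : Fin 3 → interval.Cochain V, evalFree (interval.bracketOps m) v r = 0}

/-- The operations on cochains determined by operations `m` on `V`. -/
def CochainModel.extend (m : BinOps K (E × E) V) : BinOps K E (D.Cochain V) :=
  D.ops (fun i j k => (D.cup i j k • LinearMap.id).prod (D.cupOp i j k • LinearMap.id)) m

theorem CochainModel.extend_single (m : BinOps K (E × E) V) (e : E) (i j k : I) (x y : V) :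
    D.extend m e (Pi.single i x) (Pi.single j y) k =
      m (D.cup i j k • e, D.cupOp i j k • e) x y := by
  simp [extend, ops_single]

theorem CochainModel.ext_single {M N : BinOps K E (D.Cochain V)}
    (h : ∀ e i j k x y, M e (Pi.single i x) (Pi.single j y) k =
      N e (Pi.single i x) (Pi.single j y) k) : M = N := by
  refine LinearMap.ext fun e => ?_
  refine LinearMap.pi_ext fun i x => LinearMap.pi_ext fun j y => funext fun k => h e i j k x y

theorem CochainModel.IsLocalDG.pullback {M : BinOps K P.E (D.Cochain V)}
    (hM : D.IsLocalDG P M) (φ : O ⟶ P) : D.IsLocalDG O (M ∘ₗ BQOperad.onGen φ) where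
  isAlgebra := hM.isAlgebra.pullback φ
  degree _ := hM.degree _
  leibniz _ := hM.leibniz _
  isLocal X hX _ := hM.isLocal X hX _

theorem sum_cell {M : Type*} [AddCommMonoid M] (f : Cell → M) :
    ∑ i, f i = f .left + (f .right + f .edge) := by
  change ∑ i ∈ ({.left, .right, .edge} : Finset Cell), f i = _
  rw [Finset.sum_insert (by decide), Finset.sum_insert (by decide), Finset.sum_singleton]

theorem sum_relCell {M : Type*} [AddCommMonoid M] (f : RelCell → M) :
    ∑ i, f i = f .right + f .edge := by
  change ∑ i ∈ ({.right, .edge} : Finset RelCell), f i = _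
  rw [Finset.sum_insert (by decide), Finset.sum_singleton]

theorem interval_d (α : interval.Cochain V) (k : Cell) :
    interval.d α k = match k with
      | .edge => α Cell.right - α Cell.left
      | _ => 0 := by
  refine (sum_cell fun i => interval.bd i k • α i).trans ?_
  cases k <;> simp [interval]
  abel

theorem relInterval_d (α : relInterval.Cochain V) (k : RelCell) :
    relInterval.d α k = match k with
      | .edge => α RelCell.right
      | _ => 0 := by
  refine (sum_relCell fun i => relInterval.bd i k • α i).trans ?_
  cases k <;> simp [relInterval]

theorem interval_extend (m : BinOps K (P.E × P.E) V) (e : P.E)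
    (α β : interval.Cochain V) (k : Cell) :
    interval.extend m e α β k = match k with
      | .left => m (e, e) (α Cell.left) (β Cell.left)
      | .right => m (e, e) (α Cell.right) (β Cell.right)
      | .edge => m (e, 0) (α Cell.left) (β Cell.edge) + m (e, 0) (α Cell.edge) (β Cell.right) +
          (m (0, e) (α Cell.right) (β Cell.edge) + m (0, e) (α Cell.edge) (β Cell.left)) := by
  rw [extend, ops_apply]
  refine (sum_cell fun i => ∑ j, m (_, _) (α i) (β j)).trans ?_
  refine (congrArg₂ _ (sum_cell _) (congrArg₂ _ (sum_cell _) (sum_cell _))).trans ?_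
  cases k <;> simp [interval, cupOp, ← Prod.zero_eq_mk]
  abel

theorem relInterval_extend (m : BinOps K (P.E × P.E) V) (e : P.E)
    (α β : relInterval.Cochain V) (k : RelCell) :
    relInterval.extend m e α β k = match k with
      | .right => m (e, e) (α RelCell.right) (β RelCell.right)
      | .edge => m (e, 0) (α RelCell.edge) (β RelCell.right) +
          m (0, e) (α RelCell.right) (β RelCell.edge) := by
  rw [extend, ops_apply]
  refine (sum_relCell fun i => ∑ j, m (_, _) (α i) (β j)).trans ?_
  refine (congrArg₂ _ (sum_relCell _) (sum_relCell _)).trans ?_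
  cases k <;> simp [relInterval, cupOp, ← Prod.zero_eq_mk, add_comm]

theorem interval_d_single (i : Cell) (x : V) :
    interval.d (Pi.single i x) = match i with
      | .left => Pi.single Cell.edge (-x)
      | .right => Pi.single Cell.edge x
      | .edge => 0 := by
  funext k
  rw [interval_d]
  cases i <;> cases k <;> simp

theorem relInterval_d_single (i : RelCell) (x : V) :
    relInterval.d (Pi.single i x) = match i with
      | .right => Pi.single RelCell.edge x
      | .edge => 0 := by
  funext k
  rw [relInterval_d]
  cases i <;> cases k <;> simp

theorem interval_eq_extend {M : BinOps K O.E (interval.Cochain V)}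
    (hM : interval.IsLocalDG O M) : M = interval.extend (interval.induced M) := by
  have hdeg : ∀ e (i j k : Cell) (x y : V), interval.deg k ≠ interval.deg i + interval.deg j →
      M e (Pi.single i x) (Pi.single j y) k = 0 := hM.degree
  have hl : ∀ e (i j : Cell) (x y : V), i ≠ .left ∨ j ≠ .left →
      M e (Pi.single i x) (Pi.single j y) Cell.left = 0 := by
    intro e i j x y h
    have := fun α β => hM.isLocal {Cell.left} (by rintro _ rfl; rfl) e α β
    rcases h with h | h
    · exact (this (Pi.single i x) (Pi.single j y) (by rintro _ rfl; simp [h.symm])).1 _ rfl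
    · exact (this (Pi.single j y) (Pi.single i x) (by rintro _ rfl; simp [h.symm])).2 _ rfl
  have hr : ∀ e (i j : Cell) (x y : V), i ≠ .right ∨ j ≠ .right →
      M e (Pi.single i x) (Pi.single j y) Cell.right = 0 := by
    intro e i j x y h
    have := fun α β => hM.isLocal {Cell.right} (by rintro _ rfl; rfl) e α β
    rcases h with h | h
    · exact (this (Pi.single i x) (Pi.single j y) (by rintro _ rfl; simp [h.symm])).1 _ rfl
    · exact (this (Pi.single j y) (Pi.single i x) (by rintro _ rfl; simp [h.symm])).2 _ rfl
  have leib : ∀ e (i j : Cell) (x y : V), interval.deg i = 0 →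
      M e (Pi.single i x) (Pi.single j y) Cell.right -
          M e (Pi.single i x) (Pi.single j y) Cell.left =
        M e (interval.d (Pi.single i x)) (Pi.single j y) Cell.edge +
          M e (Pi.single i x) (interval.d (Pi.single j y)) Cell.edge := by
    intro e i j x y hi
    have h := congrFun (hM.leibniz e i x (Pi.single j y)) Cell.edge
    rw [interval_d, hi] at h
    simpa using h
  have neg : ∀ x : V, (Pi.single Cell.edge (-x) : Cell → V) = -Pi.single Cell.edge x :=
    fun x => Pi.single_neg _ _
  have hle : ∀ e (x y : V), M e (Pi.single Cell.left x) (Pi.single Cell.edge y) Cell.edge =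
      interval.under M e x y := by
    intro e x y
    have h := leib e .left .right x y rfl
    rw [interval_d_single, interval_d_single, hl e _ _ _ _ (Or.inr (by decide)),
      hr e _ _ _ _ (Or.inl (by decide))] at h
    simp only [neg, map_neg, LinearMap.neg_apply, Pi.neg_apply, sub_zero] at h
    exact (neg_add_eq_zero.1 h.symm).symm
  have hel : ∀ e (x y : V), M e (Pi.single Cell.edge x) (Pi.single Cell.left y) Cell.edge =
      interval.over M e x y := by
    intro e x y
    have h := leib e .right .left x y rfl
    rw [interval_d_single, interval_d_single, hl e _ _ _ _ (Or.inl (by decide)),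
      hr e _ _ _ _ (Or.inr (by decide))] at h
    simp only [neg, map_neg, Pi.neg_apply, sub_zero] at h
    exact add_neg_eq_zero.1 h.symm
  have hrr : ∀ e (x y : V), M e (Pi.single Cell.right x) (Pi.single Cell.right y) Cell.right =
      interval.under M e x y + interval.over M e x y := by
    intro e x y
    have h := leib e .right .right x y rfl
    rw [interval_d_single, interval_d_single, hl e _ _ _ _ (Or.inl (by decide)), sub_zero] at h
    exact h
  have hll : ∀ e (x y : V), M e (Pi.single Cell.left x) (Pi.single Cell.left y) Cell.left =
      interval.under M e x y + interval.over M e x y := by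
    intro e x y
    have h := leib e .left .left x y rfl
    rw [interval_d_single, interval_d_single, hr e _ _ _ _ (Or.inl (by decide)), zero_sub] at h
    simp only [neg, map_neg, LinearMap.neg_apply, Pi.neg_apply] at h
    rw [hel, hle, ← neg_add, neg_inj] at h
    rw [h, add_comm]
  refine interval.ext_single fun e i j k x y => ?_
  rw [interval_extend]
  cases k with
  | left =>
    by_cases h : i = .left ∧ j = .left
    · obtain ⟨rfl, rfl⟩ := h
      simp [hll, induced_apply]
    · rw [hl e i j x y (not_and_or.1 h)]
      rcases not_and_or.1 h with h | h <;> simp [Ne.symm h]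
  | right =>
    by_cases h : i = .right ∧ j = .right
    · obtain ⟨rfl, rfl⟩ := h
      simp [hrr, induced_apply]
    · rw [hr e i j x y (not_and_or.1 h)]
      rcases not_and_or.1 h with h | h <;> simp [Ne.symm h]
  | edge =>
    cases i <;> cases j <;> simp [induced_apply, hle, hel] <;>
      first
        | rfl
        | exact hdeg _ _ _ _ _ _ (by decide)

theorem relInterval_eq_extend {M : BinOps K O.E (relInterval.Cochain V)}
    (hM : relInterval.IsLocalDG O M) : M = relInterval.extend (relInterval.induced M) := by
  have hdeg : ∀ e (i j k : RelCell) (x y : V),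
      relInterval.deg k ≠ relInterval.deg i + relInterval.deg j →
      M e (Pi.single i x) (Pi.single j y) k = 0 := hM.degree
  have hrr : ∀ e (x y : V),
      M e (Pi.single RelCell.right x) (Pi.single RelCell.right y) RelCell.right =
        relInterval.under M e x y + relInterval.over M e x y := by
    intro e x y
    have h := congrFun (hM.leibniz e RelCell.right x (Pi.single RelCell.right y)) RelCell.edge
    rw [relInterval_d, relInterval_d_single, relInterval_d_single] at h
    refine h.trans ?_
    simp [relInterval, under_apply, over_apply]
  refine relInterval.ext_single fun e i j k x y => ?_
  rw [relInterval_extend]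
  cases k <;> cases i <;> cases j <;> simp [induced_apply, hrr] <;>
      first
        | rfl
        | exact hdeg _ _ _ _ _ _ (by decide)

theorem CochainModel.induced_pullback (M : BinOps K P.E (D.Cochain V)) (f : O.E →ₗ[K] P.E) :
    D.induced (M ∘ₗ f) = D.induced M ∘ₗ f.prodMap f :=
  LinearMap.ext₂ fun e x => LinearMap.ext fun y => by
    simp [induced_apply, under_apply, over_apply]

theorem interval_induced_extend (m : BinOps K (O.E × O.E) V) :
    interval.induced (interval.extend m) = m :=
  LinearMap.ext₂ fun e x => LinearMap.ext fun y => by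
    rw [induced_apply, under_apply, over_apply, extend_single, extend_single,
      ← LinearMap.add_apply, ← LinearMap.add_apply, ← map_add]
    simp [interval, cupOp]

theorem relInterval_induced_extend (m : BinOps K (O.E × O.E) V) :
    relInterval.induced (relInterval.extend m) = m :=
  LinearMap.ext₂ fun e x => LinearMap.ext fun y => by
    rw [induced_apply, under_apply, over_apply, extend_single, extend_single,
      ← LinearMap.add_apply, ← LinearMap.add_apply, ← map_add]
    simp [relInterval, cupOp]

theorem CochainModel.extend_op {m : BinOps K (O.E × O.E) V}
    (hm : ∀ e x y, m (swapOp O.op e) x y = m e y x) (e : O.E) (α β : D.Cochain V)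
    (hD : ∀ i j, D.deg i * D.deg j = 0 ∨ ∀ k, D.cup i j k = 0) :
    D.extend m (O.op e) α β = D.extend m e β α := by
  funext k
  rw [extend, ops_apply, ops_apply, Finset.sum_comm]
  refine Finset.sum_congr rfl fun i _ => Finset.sum_congr rfl fun j _ => ?_
  rw [← hm]
  congr 3
  have key : ∀ i j, D.cupOp i j k = D.cup j i k := fun i j => by
    unfold cupOp
    rw [mul_comm (D.deg i)]
    rcases hD j i with h | h
    · simp [h]
    · simp [h k]
  ext <;> simp [swapOp, key, O.op_op]

/-- The operations on cochains determined by an algebra over the operad `black` satisfy the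
identities of the original operad. -/
theorem CochainModel.extend_rel {m : BinOps K (O.E × O.E) V} (hm : (O.black D).IsAlgebra m)
    (hD : ∀ (V : Type u) [AddCommGroup V] [Module K V] (M : BinOps K O.E (D.Cochain V)),
      D.IsLocalDG O M → M = D.extend (D.induced M))
    (r : FreeOps K O.E (Fin 3)) (hr : r ∈ O.rel) (v : Fin 3 → D.Cochain V) :
    evalFree (D.extend m) v r = 0 := by
  refine D.evalFree_eq_zero (fun l x k => ?_) v
  obtain ⟨r', hr'⟩ := D.exists_expand
    (fun i j k => (D.cup i j k • (LinearMap.id : O.E →ₗ[K] O.E)).prod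
      (D.cupOp i j k • LinearMap.id)) l r k
  refine (hr' V m x).trans (hm.rel r' (fun V _ _ M hM v => ?_) x)
  rw [← hr' V (D.induced M) v]
  change evalFree (D.extend (D.induced M)) _ r k = 0
  rw [← hD V M hM, hM.isAlgebra.rel r hr]
  rfl

theorem interval_extend_isLocalDG_of {m : BinOps K (O.E × O.E) V}
    (hm : O.IsAlgebra (interval.extend m)) : interval.IsLocalDG O (interval.extend m) where
  isAlgebra := hm
  degree e i j k x y h := by
    rw [extend_single]
    have h0 : ∀ i j k : Cell, interval.deg k ≠ interval.deg i + interval.deg j →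
      interval.cup i j k = 0 ∧ interval.cupOp i j k = 0 := by decide
    simp [h0 i j k h, ← Prod.zero_eq_mk]
  leibniz e i x β := by
    funext k
    rw [interval_d, Pi.add_apply, Pi.smul_apply]
    simp only [interval_extend, interval_d_single, interval_d]
    have hs : ∀ x y, m (e, e) x y = m (e, 0) x y + m (0, e) x y := fun x y => by
      rw [← LinearMap.add_apply, ← LinearMap.add_apply, ← map_add]; simp
    cases k <;> cases i <;> simp [interval, hs]
    all_goals abel
  isLocal X hX e α β h := by
    have hc : ∀ k : Cell, interval.deg k = 0 → ∀ α β : interval.Cochain V,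
        interval.extend m e α β k = m (e, e) (α k) (β k) := by
      intro k hk α β
      rw [interval_extend]
      cases k with
      | left => rfl
      | right => rfl
      | edge => exact absurd hk (by decide)
    exact ⟨fun i hi => by rw [hc i (hX i hi), h i hi]; simp,
      fun i hi => by rw [hc i (hX i hi), h i hi]; simp⟩

theorem interval_extend_isLocalDG {m : BinOps K (O.E × O.E) V}
    (hm : (O.black interval).IsAlgebra m) : interval.IsLocalDG O (interval.extend m) :=
  interval_extend_isLocalDG_of
    { op := fun e α β => interval.extend_op hm.op e α β (by
        rintro (_ | _ | _) (_ | _ | _) <;> first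
          | exact Or.inl rfl
          | exact Or.inr (by rintro (_ | _ | _) <;> rfl))
      rel := interval.extend_rel hm fun V _ _ M hM => interval_eq_extend hM }

theorem relInterval_extend_isLocalDG_of {m : BinOps K (O.E × O.E) V}
    (hm : O.IsAlgebra (relInterval.extend m)) : relInterval.IsLocalDG O (relInterval.extend m) where
  isAlgebra := hm
  degree e i j k x y h := by
    rw [extend_single]
    have h0 : ∀ i j k : RelCell, relInterval.deg k ≠ relInterval.deg i + relInterval.deg j →
      relInterval.cup i j k = 0 ∧ relInterval.cupOp i j k = 0 := by decide
    simp [h0 i j k h, ← Prod.zero_eq_mk]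
  leibniz e i x β := by
    funext k
    rw [relInterval_d, Pi.add_apply, Pi.smul_apply]
    simp only [relInterval_extend, relInterval_d_single, relInterval_d]
    have hs : ∀ x y, m (e, e) x y = m (e, 0) x y + m (0, e) x y := fun x y => by
      rw [← LinearMap.add_apply, ← LinearMap.add_apply, ← map_add]; simp
    cases k <;> cases i <;> simp [relInterval, hs]
  isLocal X hX e α β h := by
    have hc : ∀ k : RelCell, relInterval.deg k = 0 → ∀ α β : relInterval.Cochain V,
        relInterval.extend m e α β k = m (e, e) (α k) (β k) := by
      intro k hk α β
      rw [relInterval_extend]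
      cases k with
      | right => rfl
      | edge => exact absurd hk (by decide)
    exact ⟨fun i hi => by rw [hc i (hX i hi), h i hi]; simp,
      fun i hi => by rw [hc i (hX i hi), h i hi]; simp⟩

theorem relInterval_extend_isLocalDG {m : BinOps K (O.E × O.E) V}
    (hm : (O.black relInterval).IsAlgebra m) :
    relInterval.IsLocalDG O (relInterval.extend m) :=
  relInterval_extend_isLocalDG_of
    { op := fun e α β => relInterval.extend_op hm.op e α β (by
        rintro (_ | _) (_ | _) <;> first
          | exact Or.inl rfl
          | exact Or.inr (by rintro (_ | _) <;> rfl))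
      rel := relInterval.extend_rel hm fun V _ _ M hM => relInterval_eq_extend hM }

/-- The operations on `V` induced by a local dg algebra structure form an algebra over `black`. -/
theorem CochainModel.IsLocalDG.induced_isAlgebra {M : BinOps K O.E (D.Cochain V)}
    (hM : D.IsLocalDG O M) : (O.black D).IsAlgebra (D.induced M) where
  op e x y := by
    change D.induced M (O.op e.2, O.op e.1) x y = _
    simp only [induced_apply, under_apply, over_apply, hM.isAlgebra.op]
    exact add_comm _ _
  rel r hr v := hr V M hM v

/-- Algebras over `black` are the same as local dg algebra structures on cochains. -/
theorem interval_black_isAlgebra_iff (m : BinOps K (O.E × O.E) V) :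
    (O.black interval).IsAlgebra m ↔
      ∃! M : BinOps K O.E (interval.Cochain V), interval.IsLocalDG O M ∧ interval.induced M = m :=
  ⟨fun hm => ⟨interval.extend m, ⟨interval_extend_isLocalDG hm, interval_induced_extend m⟩,
    fun M hM => by rw [interval_eq_extend hM.1, hM.2]⟩,
    fun ⟨M, hM, _⟩ => hM.2 ▸ hM.1.induced_isAlgebra⟩

/-- Algebras over `black` are the same as local dg algebra structures on relative cochains. -/
theorem relInterval_black_isAlgebra_iff (m : BinOps K (O.E × O.E) V) :
    (O.black relInterval).IsAlgebra m ↔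
      ∃! M : BinOps K O.E (relInterval.Cochain V),
        relInterval.IsLocalDG O M ∧ relInterval.induced M = m :=
  ⟨fun hm => ⟨relInterval.extend m, ⟨relInterval_extend_isLocalDG hm,
      relInterval_induced_extend m⟩, fun M hM => by rw [relInterval_eq_extend hM.1, hM.2]⟩,
    fun ⟨M, hM, _⟩ => hM.2 ▸ hM.1.induced_isAlgebra⟩

/-- The pair of families of operations `m` and `-m`. -/
def signPair (m : BinOps K E V) : BinOps K (E × E) V := m.coprod (-m)

theorem CochainModel.bracketOps_eq (m : BinOps K E V) :
    D.bracketOps m = D.extend (signPair m) :=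
  LinearMap.ext₂ fun e α => LinearMap.ext fun β => funext fun k => by
    simp [bracketOps, extend, ops_apply, signPair, bracket, sub_eq_add_neg]

/-- Local dg structures with trivial associated algebra are determined by `under`. -/
theorem interval_eq_bracketOps {M : BinOps K O.E (interval.Cochain V)}
    (hM : interval.IsLocalDG O M) (h : interval.TrivialAt M) :
    M = interval.bracketOps (interval.under M) := by
  have h2 : ∀ e x y, interval.over M e x y = -interval.under M e x y := fun e x y => by
    have h1 := h e x y
    have h3 : interval.extend (interval.induced M) e (Pi.single Cell.right x)
        (Pi.single Cell.right y) Cell.right = interval.induced M (e, e) x y := by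
      rw [interval_extend]; simp
    rw [interval_eq_extend hM] at h1
    rw [eq_neg_iff_add_eq_zero, add_comm, ← interval.induced_apply M (e, e), ← h3]
    exact h1
  rw [bracketOps_eq]
  refine (interval_eq_extend hM).trans (congrArg interval.extend ?_)
  refine LinearMap.ext₂ fun e x => LinearMap.ext fun y => ?_
  rw [induced_apply, h2]
  simp [signPair]

theorem interval_under_bracketOps (m : BinOps K O.E V) :
    interval.under (interval.bracketOps m) = m := by
  refine LinearMap.ext₂ fun e x => LinearMap.ext fun y => ?_
  have h := congrArg (fun f => f (e, 0) x y) (interval_induced_extend (signPair m))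
  rw [bracketOps_eq]
  simpa [induced_apply, signPair] using h

theorem interval_extend_right (m : BinOps K (O.E × O.E) V) (e : O.E) (x y : V) :
    interval.extend m e (Pi.single interval.right x) (Pi.single interval.right y) interval.right =
      m (e, e) x y := by
  have h : interval.extend m e (Pi.single Cell.right x)
      (Pi.single Cell.right y) Cell.right = m (e, e) x y := by
    rw [interval_extend]; simp
  exact h

theorem interval_bracketOps_trivialAt (m : BinOps K O.E V) :
    interval.TrivialAt (interval.bracketOps m) := by
  intro e x y
  rw [bracketOps_eq, interval_extend_right]
  simp [signPair]

theorem interval_bracketOps_isLocalDG {m : BinOps K O.E V} (hm : O.comBlack.IsAlgebra m) :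
    interval.IsLocalDG O (interval.bracketOps m) := by
  have hop : ∀ e x y, m (O.op e) x y = -m e y x := fun e x y => by
    have h : m (-O.op e) x y = m e y x := hm.op e x y
    rw [← h]
    simp
  have hrel : ∀ r ∈ O.rel, ∀ v : Fin 3 → interval.Cochain V,
      evalFree (interval.bracketOps m) v r = 0 := by
    intro r hr v
    refine interval.evalFree_eq_zero (fun l x k => ?_) v
    obtain ⟨r', hr'⟩ := interval.exists_expand
      (fun i j k => interval.bracket i j k • (LinearMap.id : O.E →ₗ[K] O.E)) l r k
    refine (hr' V m x).trans (hm.rel r' (fun V _ _ M hM hM' v => ?_) x)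
    rw [← hr' V (interval.under M) v]
    change evalFree (interval.bracketOps (interval.under M)) _ r k = 0
    rw [← interval_eq_bracketOps hM hM', hM.isAlgebra.rel r hr]
    rfl
  rw [bracketOps_eq] at hrel ⊢
  refine interval_extend_isLocalDG_of
    { op := fun e α β => interval.extend_op (fun e x y => ?_) e α β (by
        rintro (_ | _ | _) (_ | _ | _) <;> first
          | exact Or.inl rfl
          | exact Or.inr (by rintro (_ | _ | _) <;> rfl))
      rel := hrel }
  simp [signPair, swapOp, hop, add_comm]

/-- The operations on `V` induced by a local dg algebra structure with trivial associated algebra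
form an algebra over `comBlack`. -/
theorem under_isAlgebra {M : BinOps K O.E (interval.Cochain V)} (hM : interval.IsLocalDG O M)
    (h : interval.TrivialAt M) : O.comBlack.IsAlgebra (interval.under M) where
  op e x y := by
    change interval.under M (-O.op e) x y = _
    rw [map_neg, LinearMap.neg_apply, LinearMap.neg_apply, neg_eq_iff_add_eq_zero, add_comm]
    have h1 := h e y x
    rw [interval_eq_extend hM, interval_extend_right, induced_apply] at h1
    rw [← h1]
    congr 1
    exact congrFun (hM.isAlgebra.op e _ _) _
  rel r hr v := hr V M hM h v

/-- Algebras over `comBlack` are the same as local dg algebra structures on cochains with trivial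
associated algebra. -/
theorem comBlack_isAlgebra_iff (m : BinOps K O.E V) :
    O.comBlack.IsAlgebra m ↔ ∃! M : BinOps K O.E (interval.Cochain V),
      (interval.IsLocalDG O M ∧ interval.TrivialAt M) ∧ interval.under M = m :=
  ⟨fun hm => ⟨interval.bracketOps m, ⟨⟨interval_bracketOps_isLocalDG hm,
      interval_bracketOps_trivialAt m⟩, interval_under_bracketOps m⟩,
      fun M hM => by rw [interval_eq_bracketOps hM.1.1 hM.1.2, hM.2]⟩,
    fun ⟨M, hM, _⟩ => hM.2 ▸ under_isAlgebra hM.1.1 hM.1.2⟩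

theorem swapOp_prodMap (φ : O ⟶ P) (e : O.E × O.E) :
    (BQOperad.onGen (O := O) (P := P) φ).prodMap (BQOperad.onGen (O := O) (P := P) φ) (swapOp O.op e) =
      swapOp P.op ((BQOperad.onGen (O := O) (P := P) φ).prodMap (BQOperad.onGen (O := O) (P := P) φ) e) := by
  simp [swapOp, BQOperad.onGen_op]

theorem interval_black_pullback (φ : O ⟶ P) {m : BinOps K (P.E × P.E) V}
    (hm : (P.black interval).IsAlgebra m) : (O.black interval).IsAlgebra
      (m ∘ₗ (BQOperad.onGen (O := O) (P := P) φ).prodMap (BQOperad.onGen (O := O) (P := P) φ)) := by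
  have h := ((interval_extend_isLocalDG hm).pullback interval φ).induced_isAlgebra
  rwa [induced_pullback, interval_induced_extend] at h

theorem relInterval_black_pullback (φ : O ⟶ P) {m : BinOps K (P.E × P.E) V}
    (hm : (P.black relInterval).IsAlgebra m) : (O.black relInterval).IsAlgebra
      (m ∘ₗ (BQOperad.onGen (O := O) (P := P) φ).prodMap (BQOperad.onGen (O := O) (P := P) φ)) := by
  have h := ((relInterval_extend_isLocalDG hm).pullback relInterval φ).induced_isAlgebra
  rwa [induced_pullback, relInterval_induced_extend] at h

theorem comBlack_pullback (φ : O ⟶ P) {m : BinOps K P.E V}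
    (hm : P.comBlack.IsAlgebra m) : O.comBlack.IsAlgebra (m ∘ₗ BQOperad.onGen (O := O) (P := P) φ) := by
  have h := under_isAlgebra ((interval_bracketOps_isLocalDG hm).pullback interval φ)
    (fun e x y => interval_bracketOps_trivialAt m _ x y)
  have h1 : interval.under (interval.bracketOps m ∘ₗ BQOperad.onGen (O := O) (P := P) φ) =
      m ∘ₗ BQOperad.onGen (O := O) (P := P) φ :=
    LinearMap.ext₂ fun e x => LinearMap.ext fun y =>
      congrArg (fun f => f (BQOperad.onGen (O := O) (P := P) φ e) x y) (interval_under_bracketOps m)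
  rwa [h1] at h

theorem white_pullback (φ : O ⟶ P) {m : BinOps K (P.E × P.E) V}
    (hm : (P.white D).IsAlgebra m) : (O.white D).IsAlgebra
      (m ∘ₗ (BQOperad.onGen (O := O) (P := P) φ).prodMap (BQOperad.onGen (O := O) (P := P) φ)) where
  op e x y := by
    rw [LinearMap.comp_apply, LinearMap.comp_apply]
    exact (congrArg (fun f => m f x y) (swapOp_prodMap φ e)).trans (hm.op _ x y)
  rel r hr v := by
    rw [← evalFree_mapOps]
    refine hm.rel _ (fun V _ _ m' hm' v' => ?_) v
    have h := hr V _ (hm'.pullback φ) v'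
    rw [evalFree_mapOps]
    refine Eq.trans (congrArg (fun M => evalFree M v' r) ?_) h
    refine LinearMap.ext₂ fun e α => LinearMap.ext fun β => funext fun k => ?_
    simp [cupOps, ops_apply]

theorem lieWhite_pullback (φ : O ⟶ P) {m : BinOps K P.E V}
    (hm : P.lieWhite.IsAlgebra m) : O.lieWhite.IsAlgebra (m ∘ₗ BQOperad.onGen (O := O) (P := P) φ) where
  op e x y := by
    rw [LinearMap.comp_apply, LinearMap.comp_apply]
    refine Eq.trans (congrArg (fun f => m f x y) ?_) (hm.op _ x y)
    change BQOperad.onGen (O := O) (P := P) φ (-O.op e) = -P.op _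
    rw [map_neg, BQOperad.onGen_op]
  rel r hr v := by
    rw [← evalFree_mapOps]
    refine hm.rel _ (fun V _ _ m' hm' v' => ?_) v
    have h := hr V _ (hm'.pullback φ) v'
    rw [evalFree_mapOps]
    refine Eq.trans (congrArg (fun M => evalFree M v' r) ?_) h
    refine LinearMap.ext₂ fun e α => LinearMap.ext fun β => funext fun k => ?_
    simp [bracketOps, ops_apply]

theorem onGen_prodMap_id (O : BQOperad K) :
    (BQOperad.onGen (𝟙 O)).prodMap (BQOperad.onGen (𝟙 O)) = LinearMap.id := by
  rw [BQOperad.onGen_id]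
  exact LinearMap.prodMap_id

theorem onGen_prodMap_comp {Q : BQOperad K} (φ : O ⟶ P) (ψ : P ⟶ Q) :
    (BQOperad.onGen (φ ≫ ψ)).prodMap (BQOperad.onGen (φ ≫ ψ)) =
      (BQOperad.onGen ψ).prodMap (BQOperad.onGen ψ) ∘ₗ
        (BQOperad.onGen φ).prodMap (BQOperad.onGen φ) := by
  rw [BQOperad.onGen_comp]
  exact (LinearMap.prodMap_comp _ _ _ _).symm

theorem lift_eq_id {f : O.E →ₗ[K] O.E} (h : f = LinearMap.id)
    (hf : ∀ (V : Type u) [AddCommGroup V] [Module K V] (m : BinOps K O.E V),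
      O.IsAlgebra m → O.IsAlgebra (m ∘ₗ f)) : BQOperad.lift f hf = 𝟙 O := by
  subst h
  exact BQOperad.hom_ext_apply fun A _ p => BQOperad.Ops.ext fun V _ _ m hm v =>
    BQOperad.eval_lift _ hf hm v p

theorem lift_comp_lift {Q : BQOperad K} (f : O.E →ₗ[K] P.E) (g : P.E →ₗ[K] Q.E)
    (h : O.E →ₗ[K] Q.E) (hfg : h = g ∘ₗ f)
    (hf : ∀ (V : Type u) [AddCommGroup V] [Module K V] (m : BinOps K P.E V),
      P.IsAlgebra m → O.IsAlgebra (m ∘ₗ f))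
    (hg : ∀ (V : Type u) [AddCommGroup V] [Module K V] (m : BinOps K Q.E V),
      Q.IsAlgebra m → P.IsAlgebra (m ∘ₗ g))
    (hh : ∀ (V : Type u) [AddCommGroup V] [Module K V] (m : BinOps K Q.E V),
      Q.IsAlgebra m → O.IsAlgebra (m ∘ₗ h)) :
    BQOperad.lift h hh = BQOperad.lift f hf ≫ BQOperad.lift g hg := by
  subst hfg
  refine BQOperad.hom_ext_apply fun A _ p => BQOperad.Ops.ext fun V _ _ m hm v => ?_
  rw [BQOperad.eval_lift]
  refine Eq.trans ?_ (BQOperad.eval_lift g hg hm v _).symm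
  exact (BQOperad.eval_lift f hf (hg V m hm) v p).symm

variable (K)

/-- The functor `Ass_•`. On generating operations it is `(a, b) ↦ (φ a, φ b)`. -/
noncomputable def assBlack : BQOperad K ⥤ BQOperad K where
  obj O := O.black interval
  map {O P} φ := BQOperad.lift (O := O.black interval) (P := P.black interval)
    ((BQOperad.onGen (O := O) (P := P) φ).prodMap (BQOperad.onGen (O := O) (P := P) φ)) fun _ _ _ _ hm => interval_black_pullback φ hm
  map_id O := lift_eq_id (O := O.black interval) (onGen_prodMap_id O) _
  map_comp {O P Q} φ ψ := lift_comp_lift (O := O.black interval) (P := P.black interval)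
    (Q := Q.black interval) _ _ _ (onGen_prodMap_comp φ ψ) _ _ _

/-- The functor `Ass_∘`. On generating operations it is `(a, b) ↦ (φ a, φ b)`. -/
noncomputable def assWhite : BQOperad K ⥤ BQOperad K where
  obj O := O.white interval
  map {O P} φ := BQOperad.lift (O := O.white interval) (P := P.white interval)
    ((BQOperad.onGen (O := O) (P := P) φ).prodMap (BQOperad.onGen (O := O) (P := P) φ)) fun _ _ _ _ hm => white_pullback interval φ hm
  map_id O := lift_eq_id (O := O.white interval) (onGen_prodMap_id O) _
  map_comp {O P Q} φ ψ := lift_comp_lift (O := O.white interval) (P := P.white interval)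
    (Q := Q.white interval) _ _ _ (onGen_prodMap_comp φ ψ) _ _ _

/-- The functor `Com_•`. On generating operations it is given by `φ`. -/
noncomputable def comBlack : BQOperad K ⥤ BQOperad K where
  obj O := O.comBlack
  map {O P} φ := BQOperad.lift (O := O.comBlack) (P := P.comBlack)
    (BQOperad.onGen (O := O) (P := P) φ) fun _ _ _ _ hm => comBlack_pullback φ hm
  map_id O := lift_eq_id (O := O.comBlack) (BQOperad.onGen_id O) _
  map_comp {O P Q} φ ψ := lift_comp_lift (O := O.comBlack) (P := P.comBlack) (Q := Q.comBlack) _ _ _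
    (BQOperad.onGen_comp φ ψ) _ _ _

/-- The functor `Lie_∘`. On generating operations it is given by `φ`. -/
noncomputable def lieWhite : BQOperad K ⥤ BQOperad K where
  obj O := O.lieWhite
  map {O P} φ := BQOperad.lift (O := O.lieWhite) (P := P.lieWhite)
    (BQOperad.onGen (O := O) (P := P) φ) fun _ _ _ _ hm => lieWhite_pullback φ hm
  map_id O := lift_eq_id (O := O.lieWhite) (BQOperad.onGen_id O) _
  map_comp {O P Q} φ ψ := lift_comp_lift (O := O.lieWhite) (P := P.lieWhite) (Q := Q.lieWhite) _ _ _
    (BQOperad.onGen_comp φ ψ) _ _ _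

/-- The functor `preLie_•`. On generating operations it is `(a, b) ↦ (φ a, φ b)`. -/
noncomputable def preLieBlack : BQOperad K ⥤ BQOperad K where
  obj O := O.black relInterval
  map {O P} φ := BQOperad.lift (O := O.black relInterval) (P := P.black relInterval)
    ((BQOperad.onGen (O := O) (P := P) φ).prodMap (BQOperad.onGen (O := O) (P := P) φ)) fun _ _ _ _ hm =>
      relInterval_black_pullback φ hm
  map_id O := lift_eq_id (O := O.black relInterval) (onGen_prodMap_id O) _
  map_comp {O P Q} φ ψ := lift_comp_lift (O := O.black relInterval) (P := P.black relInterval)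
    (Q := Q.black relInterval) _ _ _ (onGen_prodMap_comp φ ψ) _ _ _

/-- The functor `Perm_∘`. On generating operations it is `(a, b) ↦ (φ a, φ b)`. -/
noncomputable def permWhite : BQOperad K ⥤ BQOperad K where
  obj O := O.white relInterval
  map {O P} φ := BQOperad.lift (O := O.white relInterval) (P := P.white relInterval)
    ((BQOperad.onGen (O := O) (P := P) φ).prodMap (BQOperad.onGen (O := O) (P := P) φ)) fun _ _ _ _ hm =>
      white_pullback relInterval φ hm
  map_id O := lift_eq_id (O := O.white relInterval) (onGen_prodMap_id O) _
  map_comp {O P Q} φ ψ := lift_comp_lift (O := O.white relInterval) (P := P.white relInterval)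
    (Q := Q.white relInterval) _ _ _ (onGen_prodMap_comp φ ψ) _ _ _

end Functors

end ManinTrick

/-! Everything is tested on algebras. A linear map between spaces of generating operations along
which algebra structures can be pulled back defines a morphism of operads (`lift`), and a morphism
is determined by its action on generating operations (`onGen_injective`). Hence units and counits
can be given by linear maps, and naturality and the triangle identities become linear algebra.

The link between the black and the white constructions is that every local dg `O`-algebra structure
on cochains has the form `extend m`: the operation `e` acts as the cup product tensored with the
operation `under` of `e`, plus the opposite cup product tensored with the operation `over` of `e`.
Conversely, operations of this form are automatically local and compatible with the differential
once they satisfy the identities of `O`. So `extend m` is a tensor product structure in disguise,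
and this can be read in two directions.

Unit: if `V` is an algebra over the black operad, the tensor product operations on cochains with
coefficients in `V`, composed with `unitGen`, are `extend m` (`cupOps_comp_unitGen`) and form an
`O`-algebra. The relators of the white operad are all identities of such tensor products, so
`unitGen` pulls back every algebra over the white operad of the black one
(`white_black_comp_unitGen`).

Counit: if `V` is an `O`-algebra, the tensor product operations make the cochains an algebra over
the white operad. They are `extend` of the operations composed with `counitGen`
(`extend_comp_counitGen`), hence a local dg structure, so `V` becomes an algebra over the black
operad of the white one.

For `Com_•` and `Lie_∘`, triviality of the associated algebra forces `over` to be the negative of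
`under`, so that `e` acts as the bracket tensored with `under`. The space of generating operations
does not change, and unit and counit are the identity on it. -/

namespace ManinTrick

/-! ### Morphisms are determined by their action on generating operations -/

section Faithful

variable {K : Type u} [Field K] {E : Type u} {A B : Type}

/-- Partial composition takes operations with separate sets of inputs, so a subtree of a monomial
must first be regarded as a monomial in its own variables only. This is the tool for that. -/
theorem Tree.exists_restrict (X : A → Prop) (t : Tree E A) (h : ∀ a ∈ t.leaves, X a) :
    ∃ t' : Tree E {a // X a}, (t'.bind fun a => .leaf a.1) = t := by
  induction t with
  | leaf a => exact ⟨.leaf ⟨a, h a (by simp [Tree.leaves])⟩, rfl⟩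
  | node e s t hs ht =>
    simp only [Tree.leaves, List.mem_append] at h
    obtain ⟨s', rfl⟩ := hs fun a ha => h a (Or.inl ha)
    obtain ⟨t', rfl⟩ := ht fun a ha => h a (Or.inr ha)
    exact ⟨.node e s' t', rfl⟩

theorem Tree.leaves_rename (f : A → B) (t : Tree E A) :
    (t.bind fun a => .leaf (f a)).leaves = t.leaves.map f := by
  rw [Tree.leaves_bind]
  exact List.map_eq_flatMap.symm

/-- A monomial without repeated variables is multilinear in the variables that occur in it. -/
theorem Tree.exists_mono (t : Tree E A) (h : t.leaves.Nodup) :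
    ∃ t' : Mono E {a // a ∈ t.leaves}, (t'.1.bind fun a => .leaf a.1) = t := by
  obtain ⟨t', ht'⟩ := t.exists_restrict (· ∈ t.leaves) fun _ ha => ha
  have hl : t'.leaves.map Subtype.val = t.leaves := by
    rw [← Tree.leaves_rename, ht']
  refine ⟨⟨t', ?_, fun a => ?_⟩, ht'⟩
  · exact List.Nodup.of_map Subtype.val (by rw [hl]; exact h)
  · obtain ⟨b, hb, hba⟩ := List.mem_map.1 (by rw [hl]; exact a.2)
    rwa [← Subtype.ext hba]

/-- The variables of a product are those of the two factors. -/
noncomputable def leavesSumEquiv (e : E) (s t : Tree E A) (h : (Tree.node e s t).IsMultilinear) :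
    {a // a ∈ s.leaves} ⊕ {a // a ∈ t.leaves} ≃ A :=
  Equiv.ofBijective (Sum.elim Subtype.val Subtype.val) <| by
    have hn := List.nodup_append.1 h.1
    -- A variable common to both factors is excluded by the disjointness contained in `Nodup` of the
    -- concatenated list.
    refine ⟨Subtype.val_injective.sumElim Subtype.val_injective
      fun a b => hn.2.2 a.1 a.2 b.1 b.2, fun a => ?_⟩
    rcases List.mem_append.1 (h.2 a) with ha | ha
    · exact ⟨Sum.inl ⟨a, ha⟩, rfl⟩
    · exact ⟨Sum.inr ⟨a, ha⟩, rfl⟩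

variable {O P : BQOperad K} {V : Type u} [AddCommGroup V] [Module K V]

open BQOperad

/-- A morphism of operads acts on monomials through its action on the generating operations. -/
theorem BQOperad.eval_apply_mono {m : BinOps K P.E V} (hm : P.IsAlgebra m) (φ : O ⟶ P) (n : ℕ) :
    ∀ (A : Type) [Finite A] (v : A → V) (t : Mono O.E A), t.1.leaves.length = n →
      Ops.eval hm v (apply φ A (Submodule.Quotient.mk (Finsupp.single t 1))) =
        t.1.eval (m ∘ₗ onGen φ) v := by
  -- The induction is on the number of leaves, with the set of variables left free: the two factors
  -- of a product reappear as relabelled trees over smaller variable sets, to which a structural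
  -- hypothesis would not apply.
  induction n using Nat.strong_induction_on with
  | _ n ih =>
  rintro A _ v ⟨t, ht⟩ rfl
  cases t with
  | leaf a =>
    -- A multilinear monomial without operations has exactly one variable, so it is the operadic
    -- identity up to renaming, and morphisms preserve the identity.
    have hA : ∀ b, b = a := fun b => by simpa [Tree.leaves] using ht.2 b
    let σ : Unit ≃ A := ⟨fun _ => a, fun _ => (), fun _ => rfl, fun b => (hA b).symm⟩
    have h : (Submodule.Quotient.mk (Finsupp.single ⟨.leaf a, ht⟩ 1) : O.Ops A) =
        Ops.map σ (Ops.one O) := Ops.ext fun W _ _ μ hμ w => by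
      rw [Ops.eval_map, Ops.eval_one, Ops.eval_mk, evalFree_single, one_smul]
      rfl
    have h1 : apply φ Unit (Ops.one O) = Ops.one P := SymmetricOperad.Hom.app_one φ
    rw [h, apply_map, h1, Ops.eval_map, Ops.eval_one]
    rfl
  | node e s t =>
    have hn := List.nodup_append.1 ht.1
    obtain ⟨s', hs⟩ := s.exists_mono hn.1
    obtain ⟨t', ht'⟩ := t.exists_mono hn.2.1
    have : Finite {a // a ∈ s.leaves} := Subtype.finite
    have : Finite {a // a ∈ t.leaves} := Subtype.finite
    have ls : s'.1.leaves.length = s.leaves.length := by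
      have := congrArg (fun r => r.leaves.length) hs
      simpa only [Tree.leaves_rename, List.length_map] using this
    have lt : t'.1.leaves.length = t.leaves.length := by
      have := congrArg (fun r => r.leaves.length) ht'
      simpa only [Tree.leaves_rename, List.length_map] using this
    have hs0 := s.length_pos
    have ht0 := t.length_pos
    have hlen : (⟨.node e s t, ht⟩ : Mono O.E A).1.leaves.length = s.leaves.length + t.leaves.length := by
      simp [Tree.leaves]
    -- This is stated for all operations on all spaces because it serves twice: in arbitrary
    -- `O`-algebras, to decompose the monomial, and on `V` with the operations pulled back along
    -- `φ`.
    have es : ∀ (W : Type u) [AddCommGroup W] [Module K W] (μ : BinOps K O.E W) (w : A → W),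
        s'.1.eval μ (fun a => w a.1) = s.eval μ w := fun W _ _ μ w => by
      conv_rhs => rw [← hs, Tree.eval_bind]
      rfl
    have et : ∀ (W : Type u) [AddCommGroup W] [Module K W] (μ : BinOps K O.E W) (w : A → W),
        t'.1.eval μ (fun a => w a.1) = t.eval μ w := fun W _ _ μ w => by
      conv_rhs => rw [← ht', Tree.eval_bind]
      rfl
    -- The product is built by two partial compositions. First `s'` goes into the left input of `e`,
    -- marked by `markFirst`; the remaining input of `e` is then the point in `Unit`, which is moved
    -- to `none` so that it can receive `t'`. Finally the inputs are renamed to `A`.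
    have h : (Submodule.Quotient.mk (Finsupp.single ⟨.node e s t, ht⟩ 1) : O.Ops A) =
        Ops.map (leavesSumEquiv e s t ht) (Ops.comp
          (Ops.map ((Equiv.sumComm _ _).trans (Equiv.optionEquivSumPUnit _).symm)
            (Ops.comp (Ops.map markFirst (O.gen e))
              (Submodule.Quotient.mk (Finsupp.single s' 1))))
          (Submodule.Quotient.mk (Finsupp.single t' 1))) := Ops.ext fun W _ _ μ hμ w => by
      simp only [Ops.eval_map, Ops.eval_comp, eval_gen, Ops.eval_mk, evalFree_single, one_smul]
      refine Eq.trans ?_ (congrArg₂ (fun x y => μ e x y) (es W μ w).symm (et W μ w).symm)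
      rfl
    rw [h]
    simp only [apply_map, apply_comp, ← gen_onGen, Ops.eval_map, Ops.eval_comp, eval_gen]
    rw [ih _ (by omega) _ _ s' rfl, ih _ (by omega) _ _ t' rfl]
    exact congrArg₂ (fun x y => m (onGen φ e) x y) (es V _ v) (et V _ v)

/-- Operations are classes of linear combinations of monomials, and both sides are linear in `p`, so
the case of a monomial suffices. It follows that a morphism acts on operations only through the
pullback of algebra structures. -/
theorem BQOperad.eval_apply {m : BinOps K P.E V} (hm : P.IsAlgebra m) (φ : O ⟶ P) [Finite A]
    (v : A → V) (p : O.Ops A) :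
    Ops.eval hm v (apply φ A p) = Ops.eval (hm.pullback φ) v p := by
  obtain ⟨p, rfl⟩ := Submodule.Quotient.mk_surjective _ p
  induction p using Finsupp.induction_linear with
  | zero => rw [Submodule.Quotient.mk_zero]; simp
  | add p q hp hq =>
    rw [Submodule.Quotient.mk_add, map_add, map_add, hp, hq, map_add]
  | single t c =>
    have : (Finsupp.single t c : FreeOps K O.E A) = c • Finsupp.single t 1 := by simp
    rw [this, Submodule.Quotient.mk_smul, map_smul, map_smul, map_smul,
      eval_apply_mono hm φ _ A v t rfl, Ops.eval_mk, evalFree_single, one_smul]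

/-- A morphism of operads is determined by its action on the generating operations. -/
theorem BQOperad.onGen_injective {φ ψ : O ⟶ P} (h : onGen φ = onGen ψ) : φ = ψ :=
  -- Operations of `P` are separated by their values in `P`-algebras, and by `eval_apply` these
  -- values involve the morphism only through `m ∘ₗ onGen φ`.
  hom_ext_apply fun A _ p => Ops.ext fun V _ _ m hm v => by
    rw [eval_apply, eval_apply]
    congr 1
    simp only [h]

/-- Evaluation in a `P`-algebra reduces this to the definition of the pulled back operations. The
formulas for units and counits in the theorem are instances. -/
theorem BQOperad.apply_lift_gen (f : O.E →ₗ[K] P.E)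
    (hf : ∀ (V : Type u) [AddCommGroup V] [Module K V] (m : BinOps K P.E V),
      P.IsAlgebra m → O.IsAlgebra (m ∘ₗ f)) (e : O.E) :
    apply (lift f hf) (Fin 2) (O.gen e) = P.gen (f e) :=
  Ops.ext fun V _ _ m hm v => by
    rw [eval_lift, eval_gen, eval_gen]
    rfl

theorem BQOperad.onGen_lift (f : O.E →ₗ[K] P.E)
    (hf : ∀ (V : Type u) [AddCommGroup V] [Module K V] (m : BinOps K P.E V),
      P.IsAlgebra m → O.IsAlgebra (m ∘ₗ f)) : onGen (lift f hf) = f :=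
  LinearMap.ext fun e => gen_injective <| by rw [gen_onGen, apply_lift_gen]

end Faithful

/-! ### Tensor product structures and the linear maps behind unit and counit -/

section Adjunctions

variable {K : Type u} [Field K] {I : Type} [Fintype I] [DecidableEq I] (D : CochainModel I)
  {O P : BQOperad K} {E : Type u} [AddCommGroup E] [Module K E]
  {V : Type u} [AddCommGroup V] [Module K V]

open CochainModel BQOperad

variable (K E) in
/-- The linear map `e ↦ ((e, 0), (0, e))`. -/
def unitGen : E →ₗ[K] (E × E) × (E × E) := (LinearMap.inl K E E).prod (LinearMap.inr K E E)

variable (K E) in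
/-- The linear map `((a, b), (a', b')) ↦ a + b'`. -/
def counitGen : (E × E) × (E × E) →ₗ[K] E := (LinearMap.fst K E E).coprod (LinearMap.snd K E E)

/-- In `((e, 0), (0, e))` the outer pair separates the cup product from its opposite, the inner
pairs separate `under` from `over`. The coefficient of the tensor product operation is therefore the
pair formed by the `cup` and the `cupOp` multiple of `e`, which is the coefficient in `extend`. -/
theorem CochainModel.cupOps_comp_unitGen (m : BinOps K (E × E) V) :
    D.cupOps m ∘ₗ unitGen K E = D.extend m := by
  rw [cupOps, ← ops_comp, extend]
  congr 1
  funext i j k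
  ext <;> simp [unitGen]

/-- Here the outer pair separates `under` from `over`. For a generator `(a, b)`, `extend` produces
the `cup` and the `cupOp` multiple of the whole pair, and `counitGen` keeps `a` from the first and
`b` from the second, as the tensor product operations do. -/
theorem CochainModel.extend_comp_counitGen (m : BinOps K E V) :
    D.extend (m ∘ₗ counitGen K E) = D.cupOps m := by
  rw [extend, ← ops_comp', cupOps]
  congr 1

/-- If the tensor product operations satisfy the identities of `O` after composition with `g`, then
so do all algebras over the operad `white`. -/
theorem isAlgebra_comp_of_cupOps (g : O.E →ₗ[K] P.E × P.E)
    (hop : ∀ e, g (O.op e) = swapOp P.op (g e))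
    (hg : ∀ (V : Type u) [AddCommGroup V] [Module K V] (m : BinOps K P.E V),
      P.IsAlgebra m → O.IsAlgebra (D.cupOps m ∘ₗ g))
    {μ : BinOps K (P.E × P.E) V} (hμ : (P.white D).IsAlgebra μ) : O.IsAlgebra (μ ∘ₗ g) where
  op e x y := by
    rw [LinearMap.comp_apply, hop]
    exact hμ.op (g e) x y
  rel r hr v := by
    -- The map `g` is moved from the operations into the relator. The renamed relator lies in the
    -- relators of `white`, because these are all the identities valid for `cupOps` and `hg`
    -- provides this one.
    rw [← evalFree_mapOps]
    refine hμ.rel _ (fun W _ _ m hm w => ?_) v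
    rw [evalFree_mapOps]
    exact (hg W m hm).rel r hr w

/-- The same principle for the bracket: all identities valid for `bracketOps` are relators of
`lieWhite`, so the cochain algebras are a sufficient test. The sign in `hop` reflects the
antisymmetry of the bracket. -/
theorem isAlgebra_comp_of_bracketOps (g : O.E →ₗ[K] P.E) (hop : ∀ e, g (O.op e) = -P.op (g e))
    (hg : ∀ (V : Type u) [AddCommGroup V] [Module K V] (m : BinOps K P.E V),
      P.IsAlgebra m → O.IsAlgebra (interval.bracketOps m ∘ₗ g))
    {μ : BinOps K P.E V} (hμ : P.lieWhite.IsAlgebra μ) : O.IsAlgebra (μ ∘ₗ g) where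
  op e x y := by
    rw [LinearMap.comp_apply, hop]
    exact hμ.op (g e) x y
  rel r hr v := by
    rw [← evalFree_mapOps]
    refine hμ.rel _ (fun W _ _ m hm w => ?_) v
    rw [evalFree_mapOps]
    exact (hg W m hm).rel r hr w

/-- This makes the unit well defined. It is enough to look at tensor product operations over an
algebra of the black operad, where composition with `unitGen` gives `extend`; the hypothesis `h`
isolates what has to be known about the cochain model. -/
theorem white_black_comp_unitGen
    (h : ∀ (V : Type u) [AddCommGroup V] [Module K V] (m : BinOps K (O.E × O.E) V),
      (O.black D).IsAlgebra m → O.IsAlgebra (D.extend m))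
    {μ : BinOps K ((O.E × O.E) × (O.E × O.E)) V} (hμ : ((O.black D).white D).IsAlgebra μ) :
    O.IsAlgebra (μ ∘ₗ unitGen K O.E) :=
  isAlgebra_comp_of_cupOps (P := O.black D) D (unitGen K O.E)
    -- The involution of the white operad exchanges the outer entries and that of the black operad
    -- the inner ones; on `((e, 0), (0, e))` the two exchanges cancel and leave `op` applied to `e`.
    (fun e => by simp [unitGen, swapOp])
    (fun V _ _ m hm => by
      have := h V m hm
      rwa [← cupOps_comp_unitGen] at this) hμ

/-- The relators hold by the definition of `white`, so only the compatibility with opposites needs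
an argument. It is the symmetry of `extend`, applied to the operations composed with `counitGen`.
The hypothesis `hD` ensures that the Koszul sign in `cupOp` is harmless. -/
theorem CochainModel.cupOps_isAlgebra {m : BinOps K O.E V} (hm : O.IsAlgebra m)
    (hD : ∀ i j, D.deg i * D.deg j = 0 ∨ ∀ k, D.cup i j k = 0) :
    (O.white D).IsAlgebra (D.cupOps m) where
  op e α β := by
    have h := D.extend_op (O := O.white D) (m := m ∘ₗ counitGen K O.E)
      (fun e x y => by
        obtain ⟨⟨a, b⟩, c, d⟩ := e
        simp [counitGen, swapOp, hm.op, add_comm]) e α β hD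
    rwa [extend_comp_counitGen] at h
  rel r hr v := hr V m hm v

theorem interval_cupOps_isAlgebra {m : BinOps K O.E V} (hm : O.IsAlgebra m) :
    (O.white interval).IsAlgebra (interval.cupOps m) :=
  interval.cupOps_isAlgebra hm (by
    -- Only for two edge cochains is the product of degrees nonzero, and their cup product vanishes.
    rintro (_ | _ | _) (_ | _ | _) <;> first
      | exact Or.inl rfl
      | exact Or.inr (by rintro (_ | _ | _) <;> rfl))

theorem relInterval_cupOps_isAlgebra {m : BinOps K O.E V} (hm : O.IsAlgebra m) :
    (O.white relInterval).IsAlgebra (relInterval.cupOps m) :=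
  relInterval.cupOps_isAlgebra hm (by
    rintro (_ | _) (_ | _) <;> first
      | exact Or.inl rfl
      | exact Or.inr (by rintro (_ | _) <;> rfl))

/-- This makes the counit well defined: the tensor product structure over an `O`-algebra is an
`extend`, hence local dg for the white operad, and the operations it induces on the coefficients are
the given ones composed with `counitGen`. -/
theorem interval_comp_counitGen {m : BinOps K O.E V} (hm : O.IsAlgebra m) :
    ((O.white interval).black interval).IsAlgebra (m ∘ₗ counitGen K O.E) := by
  have h : interval.IsLocalDG (O.white interval) (interval.extend (m ∘ₗ counitGen K O.E)) :=
    interval_extend_isLocalDG_of (by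
      rw [extend_comp_counitGen]; exact interval_cupOps_isAlgebra hm)
  have h1 := h.induced_isAlgebra
  rwa [interval_induced_extend (O := O.white interval)] at h1

theorem relInterval_comp_counitGen {m : BinOps K O.E V} (hm : O.IsAlgebra m) :
    ((O.white relInterval).black relInterval).IsAlgebra (m ∘ₗ counitGen K O.E) := by
  have h : relInterval.IsLocalDG (O.white relInterval)
      (relInterval.extend (m ∘ₗ counitGen K O.E)) :=
    relInterval_extend_isLocalDG_of (by
      rw [extend_comp_counitGen]; exact relInterval_cupOps_isAlgebra hm)
  have h1 := h.induced_isAlgebra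
  rwa [relInterval_induced_extend (O := O.white relInterval)] at h1

/-! ### Well-definedness of unit and counit for the commutative and Lie pair -/

theorem lieWhite_comBlack_comp_id {μ : BinOps K O.E V} (hμ : O.comBlack.lieWhite.IsAlgebra μ) :
    O.IsAlgebra (μ ∘ₗ LinearMap.id) :=
  isAlgebra_comp_of_bracketOps (O := O) (P := O.comBlack) LinearMap.id
    -- `comBlack` and `lieWhite` both change the sign of the involution, so their composite restores
    -- it.
    (fun e => (neg_neg (O.op e)).symm)
    (fun _ _ _ _ hm => (interval_bracketOps_isLocalDG hm).isAlgebra) hμ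

/-- The bracket is `extend` of the pair `m`, `-m`. Exchanging the two members of this pair produces
a sign, which cancels the sign in the involution of `lieWhite`. -/
theorem bracketOps_isAlgebra {m : BinOps K O.E V} (hm : O.IsAlgebra m) :
    O.lieWhite.IsAlgebra (interval.bracketOps m) where
  op e α β := by
    have h := interval.extend_op (O := O.lieWhite) (m := signPair m)
      (fun e x y => by simp [signPair, swapOp, hm.op, add_comm]) e α β (by
        rintro (_ | _ | _) (_ | _ | _) <;> first
          | exact Or.inl rfl
          | exact Or.inr (by rintro (_ | _ | _) <;> rfl))
    rwa [← bracketOps_eq] at h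
  rel r hr v := hr V m hm v

/-- The bracket operations over an `O`-algebra form a local dg `lieWhite` structure whose associated
algebra is trivial, since the contributions of `m` and `-m` at a vertex cancel. The operation
`under` recovers `m`. -/
theorem comBlack_lieWhite_comp_id {m : BinOps K O.E V} (hm : O.IsAlgebra m) :
    O.lieWhite.comBlack.IsAlgebra (m ∘ₗ LinearMap.id) := by
  have h : interval.IsLocalDG O.lieWhite (interval.bracketOps m) := by
    rw [bracketOps_eq]
    refine interval_extend_isLocalDG_of ?_
    rw [← bracketOps_eq]
    exact bracketOps_isAlgebra hm
  have h1 := under_isAlgebra h (interval_bracketOps_trivialAt (O := O) m)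
  rwa [interval_under_bracketOps (O := O)] at h1

/-- An adjunction between endofunctors of the category of operads can be checked on generating
operations. -/
noncomputable def adjunctionOfOnGen (F G : BQOperad K ⥤ BQOperad K)
    (η : ∀ O, O ⟶ G.obj (F.obj O)) (ε : ∀ O, F.obj (G.obj O) ⟶ O)
    (hη : ∀ (O P : BQOperad K) (φ : O ⟶ P),
      onGen (η P) ∘ₗ onGen φ = onGen (G.map (F.map φ)) ∘ₗ onGen (η O))
    (hε : ∀ (O P : BQOperad K) (φ : O ⟶ P),
      onGen (ε P) ∘ₗ onGen (F.map (G.map φ)) = onGen φ ∘ₗ onGen (ε O))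
    (hl : ∀ O, onGen (ε (F.obj O)) ∘ₗ onGen (F.map (η O)) = LinearMap.id)
    (hr : ∀ O, onGen (G.map (ε O)) ∘ₗ onGen (η (G.obj O)) = LinearMap.id) : F ⊣ G :=
  Adjunction.mkOfUnitCounit
    { unit :=
        { app := η
          naturality := fun O P φ => onGen_injective <| by
            rw [onGen_comp, onGen_comp]
            exact hη O P φ }
      counit :=
        { app := ε
          naturality := fun O P φ => onGen_injective <| by
            rw [onGen_comp, onGen_comp]
            exact hε O P φ }
      left_triangle := by
        ext O
        refine onGen_injective ?_
        -- Once whiskerings and associator are evaluated at `O`, the triangle identity is an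
        -- equation of morphisms of operads, and `hl` is its restriction to generating operations.
        simp only [NatTrans.comp_app, Functor.whiskerRight_app, Functor.whiskerLeft_app,
          Functor.associator_hom_app, Category.id_comp]
        rw [onGen_comp]
        exact (hl O).trans (onGen_id _).symm
      right_triangle := by
        ext O
        refine onGen_injective ?_
        simp only [NatTrans.comp_app, Functor.whiskerRight_app, Functor.whiskerLeft_app,
          Functor.associator_inv_app, Category.id_comp]
        rw [onGen_comp]
        exact (hr O).trans (onGen_id _).symm }

/-! ### The functors on generating operations -/

theorem onGen_assBlack_map (φ : O ⟶ P) :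
    onGen ((assBlack K).map φ) = (onGen φ).prodMap (onGen φ) :=
  onGen_lift (O := O.black interval) (P := P.black interval) _ _

theorem onGen_assWhite_map (φ : O ⟶ P) :
    onGen ((assWhite K).map φ) = (onGen φ).prodMap (onGen φ) :=
  onGen_lift (O := O.white interval) (P := P.white interval) _ _

theorem onGen_preLieBlack_map (φ : O ⟶ P) :
    onGen ((preLieBlack K).map φ) = (onGen φ).prodMap (onGen φ) :=
  onGen_lift (O := O.black relInterval) (P := P.black relInterval) _ _

theorem onGen_permWhite_map (φ : O ⟶ P) :
    onGen ((permWhite K).map φ) = (onGen φ).prodMap (onGen φ) :=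
  onGen_lift (O := O.white relInterval) (P := P.white relInterval) _ _

theorem onGen_comBlack_map (φ : O ⟶ P) : onGen ((comBlack K).map φ) = onGen φ :=
  onGen_lift (O := O.comBlack) (P := P.comBlack) _ _

theorem onGen_lieWhite_map (φ : O ⟶ P) : onGen ((lieWhite K).map φ) = onGen φ :=
  onGen_lift (O := O.lieWhite) (P := P.lieWhite) _ _

/-! ### Units and counits as morphisms of operads -/

variable (O)

/-- The unit of the adjunction between `Ass_•` and `Ass_∘`. -/
noncomputable def assUnit : O ⟶ (assWhite K).obj ((assBlack K).obj O) :=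
  lift (P := (O.black interval).white interval) (unitGen K O.E) fun _ _ _ _ hμ =>
    white_black_comp_unitGen interval (fun _ _ _ _ hm => (interval_extend_isLocalDG hm).isAlgebra) hμ

/-- The counit of the adjunction between `Ass_•` and `Ass_∘`. -/
noncomputable def assCounit : (assBlack K).obj ((assWhite K).obj O) ⟶ O :=
  lift (O := (O.white interval).black interval) (counitGen K O.E) fun _ _ _ _ hm =>
    interval_comp_counitGen hm

/-- The unit of the adjunction between `preLie_•` and `Perm_∘`. -/
noncomputable def preLieUnit : O ⟶ (permWhite K).obj ((preLieBlack K).obj O) :=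
  lift (P := (O.black relInterval).white relInterval) (unitGen K O.E) fun _ _ _ _ hμ =>
    white_black_comp_unitGen relInterval
      (fun _ _ _ _ hm => (relInterval_extend_isLocalDG hm).isAlgebra) hμ

/-- The counit of the adjunction between `preLie_•` and `Perm_∘`. -/
noncomputable def preLieCounit : (preLieBlack K).obj ((permWhite K).obj O) ⟶ O :=
  lift (O := (O.white relInterval).black relInterval) (counitGen K O.E) fun _ _ _ _ hm =>
    relInterval_comp_counitGen hm

/-- The unit of the adjunction between `Com_•` and `Lie_∘`. -/
noncomputable def comUnit : O ⟶ (lieWhite K).obj ((comBlack K).obj O) :=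
  lift (P := O.comBlack.lieWhite) LinearMap.id fun _ _ _ _ hμ => lieWhite_comBlack_comp_id hμ

/-- The counit of the adjunction between `Com_•` and `Lie_∘`. -/
noncomputable def comCounit : (comBlack K).obj ((lieWhite K).obj O) ⟶ O :=
  lift (O := O.lieWhite.comBlack) LinearMap.id fun _ _ _ _ hm => comBlack_lieWhite_comp_id hm

theorem onGen_assUnit : onGen (assUnit O) = unitGen K O.E :=
  onGen_lift (P := (O.black interval).white interval) _ _

theorem onGen_assCounit : onGen (assCounit O) = counitGen K O.E :=
  onGen_lift (O := (O.white interval).black interval) _ _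

theorem onGen_preLieUnit : onGen (preLieUnit O) = unitGen K O.E :=
  onGen_lift (P := (O.black relInterval).white relInterval) _ _

theorem onGen_preLieCounit : onGen (preLieCounit O) = counitGen K O.E :=
  onGen_lift (O := (O.white relInterval).black relInterval) _ _

theorem onGen_comUnit : onGen (comUnit O) = LinearMap.id :=
  onGen_lift (P := O.comBlack.lieWhite) _ _

theorem onGen_comCounit : onGen (comCounit O) = LinearMap.id :=
  onGen_lift (O := O.lieWhite.comBlack) _ _

/-! ### Naturality and triangle identities as linear algebra -/

section GeneratingMaps

variable {E' : Type u} [AddCommGroup E'] [Module K E']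

theorem unitGen_comp (f : E →ₗ[K] E') :
    unitGen K E' ∘ₗ f = ((f.prodMap f).prodMap (f.prodMap f)) ∘ₗ unitGen K E := by
  ext <;> simp [unitGen]

theorem counitGen_comp (f : E →ₗ[K] E') :
    counitGen K E' ∘ₗ ((f.prodMap f).prodMap (f.prodMap f)) = f ∘ₗ counitGen K E := by
  ext <;> simp [counitGen]

variable (K E)

/-- The left triangle: `(a, b)` goes to `(((a, 0), (0, a)), ((b, 0), (0, b)))`, from which
`counitGen` takes the outermost entries `(a, 0)` and `(0, b)`, with sum `(a, b)`. -/
theorem counitGen_comp_prodMap_unitGen :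
    counitGen K (E × E) ∘ₗ (unitGen K E).prodMap (unitGen K E) = LinearMap.id := by
  ext <;> simp [counitGen, unitGen]

/-- The right triangle: `(a, b)` goes to `(((a, b), 0), (0, (a, b)))`, and `counitGen` gives `a` on
the first half and `b` on the second. -/
theorem prodMap_counitGen_comp_unitGen :
    (counitGen K E).prodMap (counitGen K E) ∘ₗ unitGen K (E × E) = LinearMap.id := by
  ext <;> simp [counitGen, unitGen]

end GeneratingMaps

/-! ### The three adjunctions -/

variable (K)

/-- The adjunction between `Ass_•` and `Ass_∘`. -/
noncomputable def assAdjunction : assBlack K ⊣ assWhite K :=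
  adjunctionOfOnGen _ _ assUnit assCounit
    (fun O P φ => by
      rw [onGen_assWhite_map, onGen_assBlack_map, onGen_assUnit, onGen_assUnit]
      exact unitGen_comp (onGen φ))
    (fun O P φ => by
      rw [onGen_assBlack_map, onGen_assWhite_map, onGen_assCounit, onGen_assCounit]
      exact counitGen_comp (onGen φ))
    (fun O => by
      rw [onGen_assBlack_map, onGen_assUnit, onGen_assCounit]
      exact counitGen_comp_prodMap_unitGen K O.E)
    (fun O => by
      rw [onGen_assWhite_map, onGen_assUnit, onGen_assCounit]
      exact prodMap_counitGen_comp_unitGen K O.E)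

/-- The adjunction between `preLie_•` and `Perm_∘`. -/
noncomputable def preLieAdjunction : preLieBlack K ⊣ permWhite K :=
  adjunctionOfOnGen _ _ preLieUnit preLieCounit
    (fun O P φ => by
      rw [onGen_permWhite_map, onGen_preLieBlack_map, onGen_preLieUnit, onGen_preLieUnit]
      exact unitGen_comp (onGen φ))
    (fun O P φ => by
      rw [onGen_preLieBlack_map, onGen_permWhite_map, onGen_preLieCounit, onGen_preLieCounit]
      exact counitGen_comp (onGen φ))
    (fun O => by
      rw [onGen_preLieBlack_map, onGen_preLieUnit, onGen_preLieCounit]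
      exact counitGen_comp_prodMap_unitGen K O.E)
    (fun O => by
      rw [onGen_permWhite_map, onGen_preLieUnit, onGen_preLieCounit]
      exact prodMap_counitGen_comp_unitGen K O.E)

/-- The adjunction between `Com_•` and `Lie_∘`. -/
noncomputable def comAdjunction : comBlack K ⊣ lieWhite K :=
  adjunctionOfOnGen _ _ comUnit comCounit
    (fun O P φ => by
      -- Both functors keep the map on generating operations, and unit and counit are the identity
      -- there, so all four conditions hold trivially.
      rw [onGen_lieWhite_map, onGen_comBlack_map, onGen_comUnit, onGen_comUnit]
      rfl)
    (fun O P φ => by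
      rw [onGen_comBlack_map, onGen_lieWhite_map, onGen_comCounit, onGen_comCounit]
      rfl)
    (fun O => by
      rw [onGen_comBlack_map, onGen_comUnit, onGen_comCounit]
      rfl)
    (fun O => by
      rw [onGen_lieWhite_map, onGen_comUnit, onGen_comCounit]
      rfl)

end Adjunctions

end ManinTrick

theorem theorem2p14 (K : Type u) [Field K] :
    (∃ adj : ManinTrick.assBlack K ⊣ ManinTrick.assWhite K,
      (∀ (O : ManinTrick.BQOperad K) (e : O.E),
        ManinTrick.BQOperad.apply (O := O)
            (P := (O.black ManinTrick.interval).white ManinTrick.interval)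
            (adj.unit.app O) (Fin 2) (O.gen e) =
          ((O.black ManinTrick.interval).white ManinTrick.interval).gen ((e, 0), (0, e))) ∧
      ∀ (O : ManinTrick.BQOperad K) (a b a' b' : O.E),
        ManinTrick.BQOperad.apply
            (O := (O.white ManinTrick.interval).black ManinTrick.interval) (P := O)
            (adj.counit.app O) (Fin 2)
            (((O.white ManinTrick.interval).black ManinTrick.interval).gen ((a, b), (a', b'))) =
          O.gen (a + b')) ∧
    (∃ adj : ManinTrick.comBlack K ⊣ ManinTrick.lieWhite K,
      (∀ (O : ManinTrick.BQOperad K) (e : O.E),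
        ManinTrick.BQOperad.apply (O := O) (P := O.comBlack.lieWhite)
            (adj.unit.app O) (Fin 2) (O.gen e) = O.comBlack.lieWhite.gen e) ∧
      ∀ (O : ManinTrick.BQOperad K) (e : O.E),
        ManinTrick.BQOperad.apply (O := O.lieWhite.comBlack) (P := O)
            (adj.counit.app O) (Fin 2) (O.lieWhite.comBlack.gen e) = O.gen e) ∧
    ∃ adj : ManinTrick.preLieBlack K ⊣ ManinTrick.permWhite K,
      (∀ (O : ManinTrick.BQOperad K) (e : O.E),
        ManinTrick.BQOperad.apply (O := O)
            (P := (O.black ManinTrick.relInterval).white ManinTrick.relInterval)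
            (adj.unit.app O) (Fin 2) (O.gen e) =
          ((O.black ManinTrick.relInterval).white ManinTrick.relInterval).gen ((e, 0), (0, e))) ∧
      ∀ (O : ManinTrick.BQOperad K) (a b a' b' : O.E),
        ManinTrick.BQOperad.apply
            (O := (O.white ManinTrick.relInterval).black ManinTrick.relInterval) (P := O)
            (adj.counit.app O) (Fin 2)
            (((O.white ManinTrick.relInterval).black ManinTrick.relInterval).gen
              ((a, b), (a', b'))) =
          O.gen (a + b') := by
  refine ⟨⟨ManinTrick.assAdjunction K, fun O e => ?_, fun O a b a' b' => ?_⟩,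
    ⟨ManinTrick.comAdjunction K, fun O e => ?_, fun O e => ?_⟩,
    ManinTrick.preLieAdjunction K, fun O e => ?_, fun O a b a' b' => ?_⟩
  -- The components of the unit and the counit of these adjunctions are by construction the lifts of
  -- `unitGen`, `counitGen` or the identity, so each formula is the value of a lift on a generator.
  · exact ManinTrick.BQOperad.apply_lift_gen
      (P := (O.black ManinTrick.interval).white ManinTrick.interval) _ _ e
  -- The four entries `a`, `b`, `a'`, `b'` stand for `under` of cup, `under` of opposite cup, `over`
  -- of cup and `over` of opposite cup; the value `a + b'` records all four cases of the counit at
  -- once.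
  · exact ManinTrick.BQOperad.apply_lift_gen
      (O := (O.white ManinTrick.interval).black ManinTrick.interval) _ _ ((a, b), (a', b'))
  · exact ManinTrick.BQOperad.apply_lift_gen (P := O.comBlack.lieWhite) _ _ e
  · exact ManinTrick.BQOperad.apply_lift_gen (O := O.lieWhite.comBlack) _ _ e
  · exact ManinTrick.BQOperad.apply_lift_gen
      (P := (O.black ManinTrick.relInterval).white ManinTrick.relInterval) _ _ e
  · exact ManinTrick.BQOperad.apply_lift_gen
      (O := (O.white ManinTrick.relInterval).black ManinTrick.relInterval) _ _ ((a, b), (a', b'))
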